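/- All topological spaces are Hausdorff. Let $N\ge 0$ be an integer, let $X$ be a paracompact space with covering dimension $\dim(X)\le N$ (that is, every finite open cover of $X$ has an open refinement covering $X$ in which any $N+2$ distinct members have empty intersection), and let $E$ be a real Banach space. For each $0\le k\le N$ let $\Phi_k$ assign to every $x\in X$ a nonempty subset $\Phi_k(x)$ of $E$, and suppose that $\Phi_k$ is lower semi-continuous, i.e. $\{x\in X:\Phi_k(x)\cap U\neq\emptyset\}$ is open in $X$ for every open $U\subset E$. Let $\mathbb S^i$ and $\mathbb B^{i+1}$ denote the unit sphere and the closed unit ball of $\mathbb R^{i+1}$. Suppose that for every $0\le k<N$: (a) the family $\{\Phi_k(x):x\in X\}$ is uniformly equi-$LC^k$, i.e. for every $\varepsilon>0$ there is $\delta>0$ such that for all $x\in X$ and $0\le i\le k$, every continuous map $\mathbb S^i\to\Phi_k(x)$ whose image has diameter $<\delta$ extends to a continuous map $\mathbb B^{i+1}\to\Phi_k(x)$ whose image has diameter $<\varepsilon$; (b) $\Phi_k\hookrightarrow_k\Phi_{k+1}$, i.e. for every $x\in X$, every continuous map $\mathbb S^k\to\Phi_k(x)$ extends to a continuous map $\mathbb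 B^{k+1}\to\Phi_{k+1}(x)$. Then for every $\varepsilon>0$ the mapping $\Phi_N$ has a continuous $\varepsilon$-selection, i.e. a continuous map $f:X\to E$ such that for every $x\in X$ there is $y\in\Phi_N(x)$ with $\|f(x)-y\|<\varepsilon$. -/

import Mathlib

/-- The covering dimension of `X` is at most `n`: every finite open cover `𝒰` of `X` has an open
refinement `𝒱` (again a cover of `X`) of order at most `n`, i.e. any subfamily of `𝒱` with at
least `n + 2` members has empty intersection. -/
def CoveringDimLE (X : Type*) [TopologicalSpace X] (n : ℕ) : Prop :=
  ∀ 𝒰 : Set (Set X), 𝒰.Finite → (∀ U ∈ 𝒰, IsOpen U) → ⋃₀ 𝒰 = Set.univ →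
    ∃ 𝒱 : Set (Set X), (∀ V ∈ 𝒱, IsOpen V) ∧ ⋃₀ 𝒱 = Set.univ ∧
      (∀ V ∈ 𝒱, ∃ U ∈ 𝒰, V ⊆ U) ∧
      ∀ σ ⊆ 𝒱, ((n + 2 : ℕ) : ℕ∞) ≤ σ.encard → ⋂₀ σ = ∅

/-- The unit `k`-sphere in `ℝ^(k+1)`. -/
def unitSphere (k : ℕ) : Set (EuclideanSpace ℝ (Fin (k + 1))) :=
  Metric.sphere 0 1

/-- The closed unit `(k+1)`-ball in `ℝ^(k+1)`. -/
def unitBall (k : ℕ) : Set (EuclideanSpace ℝ (Fin (k + 1))) :=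
  Metric.closedBall 0 1

/-- The relation `S ↪ₖ B`: every continuous map of the `k`-sphere in `S` can be extended to a
continuous map of the `(k+1)`-ball in `B`. -/
def SphereExtends {Y : Type*} [TopologicalSpace Y] (k : ℕ) (S B : Set Y) : Prop :=
  ∀ g : EuclideanSpace ℝ (Fin (k + 1)) → Y,
    ContinuousOn g (unitSphere k) → Set.MapsTo g (unitSphere k) S →
    ∃ h : EuclideanSpace ℝ (Fin (k + 1)) → Y,
      ContinuousOn h (unitBall k) ∧ Set.MapsTo h (unitBall k) B ∧ Set.EqOn h g (unitSphere k)

/-- A family `𝒮` of subsets of a metric space is uniformly equi-`LC^n` (`n ≥ 0`): its members are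
nonempty (the case of the empty `(-1)`-sphere) and for every `ε > 0` there is `δ > 0` such that for
every `S ∈ 𝒮` and `k ≤ n`, every continuous map of the `k`-sphere in `S` whose image has diameter
`< δ` extends to a continuous map of the `(k+1)`-ball in `S` whose image has diameter `< ε`.
(The images are compact, so `Metric.diam` is the true diameter.) -/
def UniformlyEquiLC {Y : Type*} [MetricSpace Y] (n : ℕ) (𝒮 : Set (Set Y)) : Prop :=
  (∀ S ∈ 𝒮, S.Nonempty) ∧
  ∀ ε : ℝ, 0 < ε → ∃ δ : ℝ, 0 < δ ∧ ∀ S ∈ 𝒮, ∀ k ≤ n,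
    ∀ g : EuclideanSpace ℝ (Fin (k + 1)) → Y,
      ContinuousOn g (unitSphere k) → Set.MapsTo g (unitSphere k) S →
      Metric.diam (g '' unitSphere k) < δ →
      ∃ h : EuclideanSpace ℝ (Fin (k + 1)) → Y,
        ContinuousOn h (unitBall k) ∧ Set.MapsTo h (unitBall k) S ∧
        Set.EqOn h g (unitSphere k) ∧ Metric.diam (h '' unitBall k) < ε

/-- `f` is an `ε`-selection for `Φ`: `f x` lies in the open `ε`-neighbourhood of `Φ x`, i.e. at
distance `< ε` from some point of `Φ x`, for every `x`. -/
def IsEpsSelection {X Y : Type*} [MetricSpace Y] (ε : ℝ) (f : X → Y) (Φ : X → Set Y) : Prop :=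
  ∀ x, f x ∈ Metric.thickening ε (Φ x)

/-!
The selection is built on nerves of open covers of `X`. Given a locally finite open cover `U`, a map
`F` of the nerve of `U` into `E` is required to send each face `σ` into the `δ`-neighbourhood of
`Φ x`, for every point `x` common to the members of `U` that span `σ`. If `F` is defined on the
`N`-skeleton in this sense with respect to `Φ N`, and `U` has order at most `N`, then `F` composed
with the canonical map `X → nerve` of a partition of unity is a continuous `δ`-selection.

Such maps are constructed skeleton by skeleton, the `k`-skeleton with respect to `Φ k`
(`exists_skeletal_selection`). To pass from `k` to `k + 1`, take a face `τ` of dimension `k + 1` and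
a point `x` of the intersection of its vertices. The map of the boundary of `τ` into a
`δ`-neighbourhood of `Φ k x` can be moved slightly into `Φ k x` itself, because this set belongs to
a uniformly equi-`LC^k` family (`exists_approx_sphere`: the boundary sphere is mapped to the nerve
of a fine cover of order at most `k`, and this nerve is mapped into `Φ k x` by extending over its
simplices one dimension at a time). The moved map extends over the ball in `Φ (k + 1) x` because
`Φ k ↪ₖ Φ (k + 1)`, and adding back the small difference, coned off, gives an extension of the
original map near `Φ (k + 1) x` (`exists_approx_extension`). By lower semi-continuity and
compactness the same extension is good at all points near `x`. Hence it can be used on the nerve of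
a sufficiently fine refinement (`IsSkeletalSelection.exists_succ`).

The covering dimension enters only at the end, where a locally finite cover is shrunk to one of
order at most `N`. Since `CoveringDimLE` speaks of finite covers, this needs Dowker's theorem
(`CoveringDimLE.exists_shrinking`), which is proved by transfinite induction along a locally finite
closed cover whose members meet only finitely many sets of the given cover.
-/

open Set Filter Topology Metric

universe u v w

/-! ### Simplices in barycentric coordinates -/

section Simplices

variable {ι : Type u} {κ : Type v}

/-- The closed simplex with vertex set `σ`, in barycentric coordinates: the nonnegative functions
`p : ι → ℝ` that vanish outside `σ` and have sum `1` over `σ`. It carries the product topology of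
`ι → ℝ`, and it is empty for `σ = ∅`. -/
def coordSimplex (σ : Finset ι) : Set (ι → ℝ) :=
  {p | (∀ i, 0 ≤ p i) ∧ (∀ i, i ∉ σ → p i = 0) ∧ ∑ i ∈ σ, p i = 1}

/-- The boundary of the simplex `coordSimplex σ`: the points with a vanishing coordinate at some
vertex of `σ`. -/
def coordBoundary (σ : Finset ι) : Set (ι → ℝ) :=
  {p | p ∈ coordSimplex σ ∧ ∃ i ∈ σ, p i = 0}

lemma isClosed_coordSimplex (σ : Finset ι) : IsClosed (coordSimplex σ) := by
  have h1 : IsClosed {p : ι → ℝ | ∀ i, 0 ≤ p i} := by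
    simp only [ofPred_forall]
    exact isClosed_iInter fun i => isClosed_le continuous_const (continuous_apply i)
  have h2 : IsClosed {p : ι → ℝ | ∀ i, i ∉ σ → p i = 0} := by
    simp only [ofPred_forall]
    exact isClosed_iInter fun i => isClosed_iInter fun _ =>
      isClosed_eq (continuous_apply i) continuous_const
  have h3 : IsClosed {p : ι → ℝ | ∑ i ∈ σ, p i = 1} :=
    isClosed_eq (by fun_prop) continuous_const
  exact h1.inter (h2.inter h3)

lemma le_one_of_mem_coordSimplex {σ : Finset ι} {p : ι → ℝ} (hp : p ∈ coordSimplex σ) (i : ι) :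
    p i ≤ 1 := by
  by_cases hi : i ∈ σ
  · rw [← hp.2.2]
    exact Finset.single_le_sum (fun j _ => hp.1 j) hi
  · rw [hp.2.1 i hi]
    exact zero_le_one

lemma isCompact_coordSimplex (σ : Finset ι) : IsCompact (coordSimplex σ) := by
  refine (isCompact_univ_pi fun _ : ι => isCompact_Icc (a := (0 : ℝ)) (b := 1)).of_isClosed_subset
    (isClosed_coordSimplex σ) fun p hp i _ => ⟨hp.1 i, le_one_of_mem_coordSimplex hp i⟩

lemma coordSimplex_mono {σ τ : Finset ι} (h : σ ⊆ τ) : coordSimplex σ ⊆ coordSimplex τ := by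
  intro p hp
  refine ⟨hp.1, fun i hi => hp.2.1 i fun hi' => hi (h hi'), ?_⟩
  rw [← hp.2.2]
  exact (Finset.sum_subset h fun i _ hi => hp.2.1 i hi).symm

lemma exists_pos_of_mem_coordSimplex {σ : Finset ι} {p : ι → ℝ} (hp : p ∈ coordSimplex σ) :
    ∃ i ∈ σ, 0 < p i := by
  by_contra! h
  have : ∑ i ∈ σ, p i = 0 := Finset.sum_eq_zero fun i hi => le_antisymm (h i hi) (hp.1 i)
  rw [hp.2.2] at this
  exact one_ne_zero this

lemma mem_coordSimplex_erase [DecidableEq ι] {σ : Finset ι} {p : ι → ℝ} (hp : p ∈ coordSimplex σ)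
    {i : ι} (hi : p i = 0) : p ∈ coordSimplex (σ.erase i) := by
  refine ⟨hp.1, fun j hj => ?_, ?_⟩
  · by_cases hji : j = i
    · rw [hji, hi]
    · exact hp.2.1 j fun h => hj (Finset.mem_erase.2 ⟨hji, h⟩)
  · rw [Finset.sum_erase _ hi, hp.2.2]

lemma coordBoundary_eq_iUnion [DecidableEq ι] (σ : Finset ι) :
    coordBoundary σ = ⋃ i : σ, coordSimplex (σ.erase i) := by
  ext p
  simp only [mem_iUnion]
  constructor
  · rintro ⟨hp, i, hi, hpi⟩
    exact ⟨⟨i, hi⟩, mem_coordSimplex_erase hp hpi⟩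
  · rintro ⟨⟨i, hi⟩, hp⟩
    exact ⟨coordSimplex_mono (Finset.erase_subset _ _) hp, i, hi, hp.2.1 i (by simp)⟩

lemma continuousOn_coordBoundary [DecidableEq ι] {Y : Type*} [TopologicalSpace Y] {F : (ι → ℝ) → Y}
    {σ : Finset ι} (h : ∀ i ∈ σ, ContinuousOn F (coordSimplex (σ.erase i))) :
    ContinuousOn F (coordBoundary σ) := by
  rw [coordBoundary_eq_iUnion]
  exact (locallyFinite_of_finite _).continuousOn_iUnion (fun i => isClosed_coordSimplex _)
    fun i => h i i.2

/-- A vertex, as a point of the simplex. -/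
lemma single_mem_coordSimplex [DecidableEq ι] {σ : Finset ι} {i : ι} (hi : i ∈ σ) :
    (Pi.single i 1 : ι → ℝ) ∈ coordSimplex σ := by
  refine ⟨fun j => ?_, fun j hj => ?_, ?_⟩
  · by_cases h : j = i
    · subst h; simp
    · simp [Pi.single_eq_of_ne h]
  · exact Pi.single_eq_of_ne (fun h => hj (by rwa [h])) _
  · simp [Pi.single_apply, hi]

lemma coordSimplex_empty : coordSimplex (∅ : Finset ι) = ∅ := by
  ext p
  simp [coordSimplex]

/-- On a vertex, the affine extension of a map of the vertices takes the given value. -/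
lemma finsum_smul_eqOn_vertex {E : Type*} [AddCommMonoid E] [Module ℝ E] (v : ι → E) (i : ι) :
    EqOn (fun p : ι → ℝ => ∑ᶠ j, p j • v j) (fun _ => v i) (coordSimplex {i}) := by
  intro p hp
  have hpi : p i = 1 := by simpa using hp.2.2
  change ∑ᶠ j, p j • v j = v i
  rw [finsum_eq_single _ i, hpi, one_smul]
  intro j hj
  rw [hp.2.1 j (by simpa using hj), zero_smul]

/-- A map given on the faces with fewer than `m` vertices is extended over the faces with exactly
`m` vertices. The extensions may be chosen independently of each other, since the relative
interiors of distinct faces are disjoint. -/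
lemma exists_extend_skeleton {Y : Type*} (F : (ι → ℝ) → Y) (𝒦 : Set (Finset ι))
    (h : Finset ι → (ι → ℝ) → Y) (m : ℕ)
    (hh : ∀ τ ∈ 𝒦, τ.card = m → EqOn (h τ) F (coordBoundary τ)) :
    ∃ F' : (ι → ℝ) → Y, (∀ σ : Finset ι, σ.card < m → EqOn F' F (coordSimplex σ)) ∧
      ∀ τ ∈ 𝒦, τ.card = m → EqOn F' (h τ) (coordSimplex τ) := by
  classical
  refine ⟨fun p => if hp : ∃ τ, τ ∈ 𝒦 ∧ τ.card = m ∧ ∀ i, i ∈ τ ↔ p i ≠ 0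
    then h hp.choose p else F p, ?_, ?_⟩
  · intro σ hσ p hp
    refine dif_neg ?_
    rintro ⟨τ, -, hτ, hi⟩
    have : τ ⊆ σ := fun i hiτ => by
      by_contra hn
      exact (hi i).1 hiτ (hp.2.1 i hn)
    exact absurd (Finset.card_le_card this) (by omega)
  · intro τ hτ hc p hp
    by_cases hb : ∃ i ∈ τ, p i = 0
    · have hpb : p ∈ coordBoundary τ := ⟨hp, hb⟩
      rw [hh τ hτ hc hpb]
      refine dif_neg ?_
      rintro ⟨τ', -, hc', hi⟩
      obtain ⟨i, hiτ, hpi⟩ := hb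
      have : τ' ⊆ τ.erase i := fun j hj => by
        have hj0 := (hi j).1 hj
        refine Finset.mem_erase.2 ⟨fun h => hj0 (h ▸ hpi), ?_⟩
        by_contra hn
        exact hj0 (hp.2.1 j hn)
      have h1 := Finset.card_le_card this
      have h2 := Finset.card_erase_lt_of_mem hiτ
      omega
    · push Not at hb
      have hex : ∃ τ, τ ∈ 𝒦 ∧ τ.card = m ∧ ∀ i, i ∈ τ ↔ p i ≠ 0 :=
        ⟨τ, hτ, hc, fun i => ⟨hb i, fun h => by
          by_contra hn
          exact h (hp.2.1 i hn)⟩⟩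
      have : hex.choose = τ := by
        ext i
        rw [hex.choose_spec.2.2 i]
        exact ⟨fun h => by
          by_contra hn
          exact h (hp.2.1 i hn), hb i⟩
      change dite _ _ _ = _
      rw [dif_pos hex, this]

/-! ### Simplices and balls -/

/-- The solid standard simplex of `ℝ^n`. -/
def solidSimplex (n : ℕ) : Set (EuclideanSpace ℝ (Fin n)) :=
  {q | (∀ i, 0 ≤ q i) ∧ ∑ i, q i ≤ 1}

lemma convex_solidSimplex (n : ℕ) : Convex ℝ (solidSimplex n) := by
  rintro x ⟨hx, hx'⟩ y ⟨hy, hy'⟩ a b ha hb hab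
  refine ⟨fun i => ?_, ?_⟩
  · have := hx i
    have := hy i
    simp only [PiLp.add_apply, PiLp.smul_apply, smul_eq_mul]
    positivity
  · simp only [PiLp.add_apply, PiLp.smul_apply, smul_eq_mul, Finset.sum_add_distrib,
      ← Finset.mul_sum]
    nlinarith

lemma isClosed_solidSimplex (n : ℕ) : IsClosed (solidSimplex n) := by
  have h1 : IsClosed {q : EuclideanSpace ℝ (Fin n) | ∀ i, 0 ≤ q i} := by
    simp only [ofPred_forall]
    exact isClosed_iInter fun i => isClosed_le continuous_const
      (by fun_prop : Continuous fun q : EuclideanSpace ℝ (Fin n) => q i)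
  have h2 : IsClosed {q : EuclideanSpace ℝ (Fin n) | ∑ i, q i ≤ 1} :=
    isClosed_le (by fun_prop) continuous_const
  exact h1.inter h2

lemma isBounded_solidSimplex (n : ℕ) : Bornology.IsBounded (solidSimplex n) := by
  have hcpt : IsCompact ((EuclideanSpace.equiv (Fin n) ℝ).symm ''
      (Set.univ.pi fun _ : Fin n => Set.Icc (0 : ℝ) 1)) :=
    (isCompact_univ_pi fun _ => isCompact_Icc).image
      (EuclideanSpace.equiv (Fin n) ℝ).symm.continuous
  refine hcpt.isBounded.subset fun q hq => ⟨fun i => q i, fun i _ => ⟨hq.1 i, ?_⟩, rfl⟩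
  exact (Finset.single_le_sum (fun j _ => hq.1 j) (Finset.mem_univ i)).trans hq.2

lemma isOpen_openSimplex (n : ℕ) :
    IsOpen {q : EuclideanSpace ℝ (Fin n) | (∀ i, 0 < q i) ∧ ∑ i, q i < 1} := by
  have h1 : IsOpen {q : EuclideanSpace ℝ (Fin n) | ∀ i, 0 < q i} := by
    simp only [ofPred_forall]
    exact isOpen_iInter_of_finite fun i => isOpen_lt continuous_const
      (by fun_prop : Continuous fun q : EuclideanSpace ℝ (Fin n) => q i)
  have h2 : IsOpen {q : EuclideanSpace ℝ (Fin n) | ∑ i, q i < 1} :=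
    isOpen_lt (by fun_prop) continuous_const
  exact h1.inter h2

/-- A point of the solid simplex on a coordinate face can leave the simplex by a small move, and
all other points form an open set. -/
lemma interior_solidSimplex (n : ℕ) :
    interior (solidSimplex (n + 1)) = {q | (∀ i, 0 < q i) ∧ ∑ i, q i < 1} := by
  refine Subset.antisymm ?_ (interior_maximal (fun q hq => ⟨fun i => (hq.1 i).le, hq.2.le⟩)
    (isOpen_openSimplex _))
  intro q hq
  have hev : ∀ d : EuclideanSpace ℝ (Fin (n + 1)), ∃ t : ℝ, 0 < t ∧ q + t • d ∈
      solidSimplex (n + 1) := by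
    intro d
    have hc : Tendsto (fun t : ℝ => q + t • d) (𝓝[>] 0) (𝓝 q) := by
      have : ContinuousWithinAt (fun t : ℝ => q + t • d) (Ioi 0) 0 := by fun_prop
      simpa [ContinuousWithinAt] using this
    obtain ⟨t, ht, ht'⟩ := ((hc.eventually (mem_interior_iff_mem_nhds.1 hq)).and
      self_mem_nhdsWithin).exists
    exact ⟨t, ht', ht⟩
  have hq' := interior_subset hq
  refine ⟨fun i => ?_, ?_⟩
  · obtain ⟨t, ht, htq⟩ := hev (-EuclideanSpace.single i 1)
    have := htq.1 i
    simp at this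
    linarith
  · obtain ⟨t, ht, htq⟩ := hev (EuclideanSpace.single 0 1)
    have := htq.2
    simp [Finset.sum_add_distrib] at this
    linarith

lemma exists_homeomorph_solidSimplex (n : ℕ) :
    ∃ H : EuclideanSpace ℝ (Fin (n + 1)) ≃ₜ EuclideanSpace ℝ (Fin (n + 1)),
      H '' solidSimplex (n + 1) = unitBall n ∧
      H '' (solidSimplex (n + 1) \ {q | (∀ i, 0 < q i) ∧ ∑ i, q i < 1}) = unitSphere n := by
  have hne : (interior (solidSimplex (n + 1))).Nonempty := by
    rw [interior_solidSimplex]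
    refine ⟨WithLp.toLp 2 fun _ => 1 / (n + 2 : ℝ), fun i => ?_, ?_⟩
    · simp only
      positivity
    · simp only [Finset.sum_const, Finset.card_univ, Fintype.card_fin, nsmul_eq_mul]
      rw [mul_one_div, div_lt_one (by positivity)]
      push_cast
      linarith
  obtain ⟨H, -, h2, h3⟩ := exists_homeomorph_image_interior_closure_frontier_eq_unitBall
    (convex_solidSimplex (n + 1)) hne (isBounded_solidSimplex _)
  rw [(isClosed_solidSimplex _).closure_eq] at h2
  rw [(isClosed_solidSimplex _).frontier_eq, interior_solidSimplex] at h3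
  exact ⟨H, h2, h3⟩

/-- A simplex with `k + 2` vertices together with its boundary is a copy of the unit ball of
`ℝ^(k+1)` with its unit sphere; only what is needed to transport extension problems from the
simplex to the ball is recorded. -/
lemma exists_simplex_to_ball {τ : Finset ι} {k : ℕ} (hτ : τ.card = k + 2) :
    ∃ (r : (ι → ℝ) → EuclideanSpace ℝ (Fin (k + 1)))
      (s : EuclideanSpace ℝ (Fin (k + 1)) → (ι → ℝ)), Continuous r ∧ Continuous s ∧
      MapsTo r (coordSimplex τ) (unitBall k) ∧ MapsTo r (coordBoundary τ) (unitSphere k) ∧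
      MapsTo s (unitSphere k) (coordBoundary τ) ∧ ∀ p ∈ coordBoundary τ, s (r p) = p := by
  classical
  obtain ⟨H, hB, hS⟩ := exists_homeomorph_solidSimplex k
  let e : Fin (k + 2) ≃ τ := (Finset.equivFinOfCardEq hτ).symm
  have hsum : ∀ p : ι → ℝ, ∑ i ∈ τ, p i = p (e 0) + ∑ j : Fin (k + 1), p (e j.succ) := by
    intro p
    rw [← Fin.sum_univ_succ (fun j => p (e j)), ← Finset.sum_coe_sort τ]
    exact (Equiv.sum_comp e fun i : τ => p i).symm
  let q : (ι → ℝ) → EuclideanSpace ℝ (Fin (k + 1)) := fun p => WithLp.toLp 2 fun j => p (e j.succ)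
  let t : EuclideanSpace ℝ (Fin (k + 1)) → (ι → ℝ) := fun y i =>
    if hi : i ∈ τ then (Fin.cons (1 - ∑ j, y j) (fun j => y j) : Fin (k + 2) → ℝ) (e.symm ⟨i, hi⟩)
    else 0
  have hq : Continuous q := by fun_prop
  have ht0 : ∀ y, t y (e 0) = 1 - ∑ j, y j := fun y => by simp [t]
  have htS : ∀ y (j : Fin (k + 1)), t y (e j.succ) = y j := fun y j => by simp [t]
  have ht : Continuous t := by
    refine continuous_pi fun i => ?_
    by_cases hi : i ∈ τ
    · simp only [t, hi, dif_pos]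
      refine Fin.cases ?_ (fun j => ?_) (e.symm ⟨i, hi⟩)
      · simp only [Fin.cons_zero]
        fun_prop
      · simp only [Fin.cons_succ]
        fun_prop
    · simp only [t, hi, dif_neg, not_false_iff]
      exact continuous_const
  have hcase : ∀ {P : ι → Prop}, P (e 0) → (∀ j : Fin (k + 1), P (e j.succ)) → ∀ i ∈ τ, P i := by
    intro P h0 h1 i hi
    have : ∀ j, P (e j) := Fin.cases h0 h1
    simpa using this (e.symm ⟨i, hi⟩)
  have hqΔ : MapsTo q (coordSimplex τ) (solidSimplex (k + 1)) := by
    intro p hp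
    refine ⟨fun j => hp.1 _, ?_⟩
    have h1 := hp.2.2
    rw [hsum] at h1
    have h2 := hp.1 (e 0)
    change ∑ j : Fin (k + 1), p (e j.succ) ≤ 1
    linarith
  have htΔ : MapsTo t (solidSimplex (k + 1)) (coordSimplex τ) := by
    intro y hy
    have hnn : ∀ i ∈ τ, 0 ≤ t y i :=
      hcase (by rw [ht0]; linarith [hy.2]) fun j => by rw [htS]; exact hy.1 j
    have hz : ∀ i, i ∉ τ → t y i = 0 := fun i hi => by simp [t, hi]
    refine ⟨fun i => ?_, hz, ?_⟩
    · by_cases hi : i ∈ τ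
      · exact hnn i hi
      · rw [hz i hi]
    · rw [hsum, ht0]
      simp only [htS]
      ring
  have htq : ∀ p ∈ coordSimplex τ, t (q p) = p := by
    intro p hp
    funext i
    by_cases hi : i ∈ τ
    · revert i
      refine hcase ?_ fun j => ?_
      · rw [ht0]
        have h1 := hp.2.2
        rw [hsum] at h1
        change 1 - ∑ j : Fin (k + 1), p (e j.succ) = _
        linarith
      · rw [htS]
    · rw [hp.2.1 i hi]
      simp [t, hi]
  refine ⟨fun p => H (q p), fun y => t (H.symm y), H.continuous.comp hq,
    ht.comp H.symm.continuous, ?_, ?_, ?_, ?_⟩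
  · intro p hp
    rw [← hB]
    exact mem_image_of_mem _ (hqΔ hp)
  · rintro p ⟨hp, i, hi, hpi⟩
    rw [← hS]
    refine mem_image_of_mem _ ⟨hqΔ hp, fun hin => ?_⟩
    revert hpi
    revert i
    refine hcase ?_ fun j => ?_
    · intro h0
      have h1 := hp.2.2
      rw [hsum, h0] at h1
      have h2 : ∑ j : Fin (k + 1), p (e j.succ) < 1 := hin.2
      linarith
    · intro h0
      have h2 : 0 < p (e j.succ) := hin.1 j
      linarith
  · intro y hy
    rw [← hS] at hy
    obtain ⟨z, ⟨hz, hz'⟩, rfl⟩ := hy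
    simp only [Homeomorph.symm_apply_apply]
    refine ⟨htΔ hz, ?_⟩
    by_contra! hne
    refine hz' ⟨fun j => lt_of_le_of_ne (hz.1 j) ?_, lt_of_le_of_ne hz.2 ?_⟩
    · have := hne _ (e j.succ).2
      rw [htS] at this
      exact this.symm
    · have := hne _ (e 0).2
      rw [ht0] at this
      intro h
      exact this (by linarith)
  · intro p hp
    simp only [Homeomorph.symm_apply_apply]
    exact htq p hp.1

/-! ### Partitions of unity and maps of simplices -/

/-- A map of the nerve of a cover, continuous on each simplex, composed with the canonical map of a
subordinate partition of unity. -/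
lemma continuous_comp_partitionOfUnity {X : Type w} [TopologicalSpace X] {Y : Type*}
    [TopologicalSpace Y] (p : PartitionOfUnity ι X) {F : (ι → ℝ) → Y}
    (hF : ∀ σ : Finset ι, (∃ x, ∀ i ∈ σ, p i x ≠ 0) → ContinuousOn F (coordSimplex σ)) :
    Continuous fun x => F fun i => p i x := by
  classical
  rw [continuous_iff_continuousAt]
  intro x₀
  obtain ⟨t, ht, hfin⟩ := p.locallyFinite x₀
  let I := hfin.toFinset
  let 𝒩 : Set (Finset ι) := {σ | σ ⊆ I ∧ ∃ x, ∀ i ∈ σ, p i x ≠ 0}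
  have h𝒩 : 𝒩.Finite := (Finset.finite_toSet I.powerset).subset fun σ hσ => by
    simpa using hσ.1
  have : Finite 𝒩 := h𝒩
  have hcont : ContinuousOn F (⋃ σ : 𝒩, coordSimplex (σ : Finset ι)) :=
    (locallyFinite_of_finite _).continuousOn_iUnion (fun σ => isClosed_coordSimplex _)
      fun σ => hF _ σ.2.2
  have hmap : MapsTo (fun x i => p i x) t (⋃ σ : 𝒩, coordSimplex (σ : Finset ι)) := by
    intro x hx
    have hsub : ∀ i, p i x ≠ 0 → i ∈ I := fun i hi => hfin.mem_toFinset.2 ⟨x, hi, hx⟩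
    refine mem_iUnion.2 ⟨⟨I.filter fun i => p i x ≠ 0, Finset.filter_subset _ _, x, fun i hi =>
      (Finset.mem_filter.1 hi).2⟩, fun i => p.nonneg i x, fun i hi => ?_, ?_⟩
    · by_contra hne
      exact hi (Finset.mem_filter.2 ⟨hsub i hne, hne⟩)
    · rw [← p.sum_eq_one (mem_univ x), finsum_eq_sum_of_support_subset]
      intro i hi
      exact Finset.mem_coe.2 (Finset.mem_filter.2 ⟨hsub i hi, hi⟩)
  have hp : Continuous fun x i => p i x := continuous_pi fun i => (p i).continuous
  exact (hcont.comp hp.continuousOn hmap).continuousAt ht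

lemma exists_mem_coordSimplex_partitionOfUnity {X : Type w} [TopologicalSpace X]
    (p : PartitionOfUnity ι X) (x : X) :
    ∃ σ : Finset ι, (∀ i ∈ σ, p i x ≠ 0) ∧ (fun i => p i x) ∈ coordSimplex σ := by
  have hfin : (Function.support fun i => p i x).Finite := p.locallyFinite.point_finite x
  refine ⟨hfin.toFinset, fun i hi => by simpa using hi, fun i => p.nonneg i x, fun i hi => ?_, ?_⟩
  · simpa using hi
  · rw [← p.sum_eq_one (mem_univ x), finsum_eq_sum_of_support_subset]
    intro i hi
    simpa using hi

open Classical in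
/-- The map of barycentric coordinates induced by a map `s` of vertices: the coordinates over each
fibre of `s` are added up. -/
noncomputable def pushCoord (s : ι → κ) (p : ι → ℝ) (j : κ) : ℝ :=
  ∑ᶠ i, if s i = j then p i else 0

lemma pushCoord_eq_sum [DecidableEq κ] (s : ι → κ) {σ : Finset ι} {p : ι → ℝ}
    (hp : ∀ i, i ∉ σ → p i = 0) (j : κ) :
    pushCoord s p j = ∑ i ∈ σ, if s i = j then p i else 0 := by
  rw [pushCoord, finsum_eq_sum_of_support_subset (s := σ)]
  · exact Finset.sum_congr rfl fun i _ => by congr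
  · intro i hi
    by_contra hn
    exact hi (by simp [hp i hn])

lemma continuousOn_pushCoord (s : ι → κ) (σ : Finset ι) :
    ContinuousOn (pushCoord s) (coordSimplex σ) := by
  classical
  have : ContinuousOn (fun (p : ι → ℝ) j => ∑ i ∈ σ, if s i = j then p i else 0)
      (coordSimplex σ) := by
    refine Continuous.continuousOn (continuous_pi fun j => continuous_finsetSum _ fun i _ => ?_)
    split_ifs <;> fun_prop
  exact this.congr fun p hp => funext fun j => pushCoord_eq_sum s hp.2.1 j

lemma mapsTo_pushCoord [DecidableEq κ] (s : ι → κ) (σ : Finset ι) :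
    MapsTo (pushCoord s) (coordSimplex σ) (coordSimplex (σ.image s)) := by
  intro p hp
  have h := pushCoord_eq_sum s hp.2.1
  refine ⟨fun j => ?_, fun j hj => ?_, ?_⟩
  · rw [h]
    exact Finset.sum_nonneg fun i _ => by split_ifs <;> [exact hp.1 i; rfl]
  · rw [h]
    refine Finset.sum_eq_zero fun i hi => if_neg fun hij => hj ?_
    exact Finset.mem_image.2 ⟨i, hi, hij⟩
  · simp only [h]
    rw [Finset.sum_comm, ← hp.2.2]
    refine Finset.sum_congr rfl fun i hi => ?_
    rw [Finset.sum_ite_eq, if_pos (Finset.mem_image_of_mem _ hi)]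

lemma mapsTo_pushCoord_boundary [DecidableEq κ] {s : ι → κ} {σ : Finset ι}
    (hs : Set.InjOn s σ) :
    MapsTo (pushCoord s) (coordBoundary σ) (coordBoundary (σ.image s)) := by
  rintro p ⟨hp, i, hi, hpi⟩
  refine ⟨mapsTo_pushCoord s σ hp, s i, Finset.mem_image_of_mem _ hi, ?_⟩
  rw [pushCoord_eq_sum s hp.2.1]
  refine Finset.sum_eq_zero fun i' hi' => ?_
  split_ifs with h
  · rw [hs hi' hi h, hpi]
  · rfl

end Simplices

/-! ### Maps of simplicial complexes into uniformly equi-`LC` sets -/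

section EquiLC

variable {ι : Type u} {E : Type v} [NormedAddCommGroup E] [NormedSpace ℝ E]

/-- In a uniformly equi-`LC^n` family, an assignment of points of a member `S` to the vertices of a
complex that moves adjacent vertices only slightly apart extends to a map of the `m`-skeleton into
`S`, `m ≤ n + 1`, which keeps every simplex close to its vertices. The constant depends neither on
`S` nor on the complex. -/
lemma exists_simplicial_map {𝒮 : Set (Set E)} {n : ℕ} (h𝒮 : UniformlyEquiLC n 𝒮) :
    ∀ m ≤ n + 1, ∀ ε : ℝ, 0 < ε → ∃ δ : ℝ, 0 < δ ∧ δ ≤ ε ∧ ∀ S ∈ 𝒮, ∀ v : ι → E, (∀ i, v i ∈ S) →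
      ∀ 𝒦 : Set (Finset ι), (∀ τ ∈ 𝒦, ∀ σ ⊆ τ, σ ∈ 𝒦) →
        (∀ τ ∈ 𝒦, ∀ i ∈ τ, ∀ j ∈ τ, dist (v i) (v j) < δ) →
        ∃ F : (ι → ℝ) → E, ∀ σ ∈ 𝒦, σ.card ≤ m + 1 → ContinuousOn F (coordSimplex σ) ∧
          ∀ p ∈ coordSimplex σ, F p ∈ S ∧ ∀ i ∈ σ, dist (F p) (v i) < ε := by
  classical
  intro m
  induction m with
  | zero =>
    intro _ ε hε
    refine ⟨ε, hε, le_rfl, fun S _ v hv 𝒦 _ _ => ⟨fun p => ∑ᶠ i, p i • v i, ?_⟩⟩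
    intro σ _ hc
    rcases σ.eq_empty_or_nonempty with rfl | hσ
    · rw [coordSimplex_empty]
      exact ⟨continuousOn_empty _, fun p hp => hp.elim⟩
    · obtain ⟨i, rfl⟩ := Finset.card_eq_one.1 (le_antisymm hc hσ.card_pos)
      refine ⟨continuousOn_const.congr (finsum_smul_eqOn_vertex v i), fun p hp => ?_⟩
      have := finsum_smul_eqOn_vertex v i hp
      simp only at this ⊢
      rw [this]
      refine ⟨hv i, fun j hj => ?_⟩
      rw [Finset.mem_singleton.1 hj, dist_self]
      exact hε
  | succ m ih =>
    intro hm ε hε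
    obtain ⟨δ₀, hδ₀, hLC⟩ := h𝒮.2 (ε / 2) (by positivity)
    obtain ⟨δ, hδ, hδle, H⟩ := ih (by omega) (min (ε / 2) (δ₀ / 4)) (by positivity)
    have hle1 := min_le_left (ε / 2) (δ₀ / 4)
    have hle2 := min_le_right (ε / 2) (δ₀ / 4)
    set ε' := min (ε / 2) (δ₀ / 4)
    refine ⟨δ, hδ, by linarith, fun S hS v hv 𝒦 hdown hdiam => ?_⟩
    obtain ⟨F, hF⟩ := H S hS v hv 𝒦 hdown hdiam
    have hface : ∀ τ ∈ 𝒦, τ.card = m + 2 → ∀ i ∈ τ,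
        ContinuousOn F (coordSimplex (τ.erase i)) ∧ ∀ p ∈ coordSimplex (τ.erase i),
          F p ∈ S ∧ ∀ j ∈ τ.erase i, dist (F p) (v j) < ε' := fun τ hτ hc i hi =>
      hF _ (hdown τ hτ _ (Finset.erase_subset _ _)) (by rw [Finset.card_erase_of_mem hi]; omega)
    -- Points of the boundary of a simplex are near vertices of it, hence near each other.
    have hbd : ∀ τ ∈ 𝒦, τ.card = m + 2 → ∀ p ∈ coordBoundary τ,
        F p ∈ S ∧ ∃ i ∈ τ, dist (F p) (v i) < ε' := by
      rintro τ hτ hc p ⟨hp, i, hi, hpi⟩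
      have hp' := mem_coordSimplex_erase hp hpi
      obtain ⟨j, hj, -⟩ := exists_pos_of_mem_coordSimplex hp'
      obtain ⟨h1, h2⟩ := (hface τ hτ hc i hi).2 p hp'
      exact ⟨h1, j, Finset.mem_of_mem_erase hj, h2 j hj⟩
    have hex : ∀ τ : Finset ι, ∃ h : (ι → ℝ) → E, τ ∈ 𝒦 → τ.card = m + 2 →
        EqOn h F (coordBoundary τ) ∧ ContinuousOn h (coordSimplex τ) ∧
        ∀ p ∈ coordSimplex τ, h p ∈ S ∧ ∀ i ∈ τ, dist (h p) (v i) < ε := by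
      intro τ
      by_cases hτ : τ ∈ 𝒦 ∧ τ.card = m + 2
      swap
      · exact ⟨F, fun h1 h2 => absurd ⟨h1, h2⟩ hτ⟩
      obtain ⟨hτ, hc⟩ := hτ
      obtain ⟨r, s, hr, hs, hrB, hrS, hsB, hsr⟩ := exists_simplex_to_ball hc
      have hcont : ContinuousOn F (coordBoundary τ) :=
        continuousOn_coordBoundary fun i hi => (hface τ hτ hc i hi).1
      obtain ⟨h, hh, hhS, hhg, hhd⟩ := hLC S hS m (by omega) (F ∘ s)
        (hcont.comp hs.continuousOn hsB) (fun y hy => (hbd τ hτ hc _ (hsB hy)).1) (by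
          refine lt_of_le_of_lt (Metric.diam_le_of_forall_dist_le (C := 3 * δ₀ / 4)
            (by positivity) ?_) (by linarith)
          rintro _ ⟨y, hy, rfl⟩ _ ⟨z, hz, rfl⟩
          obtain ⟨-, i, hi, h1⟩ := hbd τ hτ hc _ (hsB hy)
          obtain ⟨-, j, hj, h2⟩ := hbd τ hτ hc _ (hsB hz)
          have h3 := hdiam τ hτ i hi j hj
          rw [dist_comm] at h2
          have := dist_triangle4 (F (s y)) (v i) (v j) (F (s z))
          simp only [Function.comp]
          linarith)
      have hhF : EqOn (h ∘ r) F (coordBoundary τ) := fun p hp => by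
        simp only [Function.comp]
        rw [hhg (hrS hp)]
        simp only [Function.comp]
        rw [hsr p hp]
      refine ⟨h ∘ r, fun _ _ => ⟨hhF, hh.comp hr.continuousOn hrB,
        fun p hp => ⟨hhS (hrB hp), fun i hi => ?_⟩⟩⟩
      have hvb : (Pi.single i 1 : ι → ℝ) ∈ coordBoundary τ := by
        obtain ⟨j, hj, hji⟩ := Finset.exists_mem_ne (by omega : 1 < τ.card) i
        exact ⟨single_mem_coordSimplex hi, j, hj, Pi.single_eq_of_ne hji _⟩
      have hve : dist (F (Pi.single i 1)) (v i) < ε' := by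
        obtain ⟨j, hj, hji⟩ := Finset.exists_mem_ne (by omega : 1 < τ.card) i
        have hi' : i ∈ τ.erase j := Finset.mem_erase.2 ⟨hji.symm, hi⟩
        exact ((hface τ hτ hc j hj).2 _ (single_mem_coordSimplex hi')).2 i hi'
      have hbdd : Bornology.IsBounded (h '' unitBall m) :=
        ((isCompact_closedBall _ _).image_of_continuousOn hh).isBounded
      have h1 : dist ((h ∘ r) p) ((h ∘ r) (Pi.single i 1)) ≤ diam (h '' unitBall m) :=
        Metric.dist_le_diam_of_mem hbdd (mem_image_of_mem _ (hrB hp))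
          (mem_image_of_mem _ (hrB hvb.1))
      rw [hhF hvb] at h1
      have := dist_triangle ((h ∘ r) p) (F (Pi.single i 1)) (v i)
      linarith
    choose h hh using hex
    obtain ⟨F', hF'1, hF'2⟩ := exists_extend_skeleton F 𝒦 h (m + 2)
      fun τ hτ hc => (hh τ hτ hc).1
    refine ⟨F', fun σ hσ hc => ?_⟩
    rcases Nat.lt_or_ge σ.card (m + 2) with hlt | hge
    · obtain ⟨h1, h2⟩ := hF σ hσ (by omega)
      refine ⟨h1.congr (hF'1 σ hlt), fun p hp => ?_⟩
      rw [hF'1 σ hlt hp]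
      exact ⟨(h2 p hp).1, fun i hi => ((h2 p hp).2 i hi).trans_le (by linarith)⟩
    · have hc' : σ.card = m + 2 := by omega
      obtain ⟨-, h1, h2⟩ := hh σ hσ hc'
      refine ⟨h1.congr (hF'2 σ hσ hc'), fun p hp => ?_⟩
      rw [hF'2 σ hσ hc' hp]
      exact h2 p hp

end EquiLC

/-! ### Fine covers of spheres -/

/-- Open subsets of the line indexed by the integers: an even index `2 * m` gives the points at
distance less than `t` from the integer `m`, an odd index `2 * m + 1` the points between `m` and
`m + 1` at distance more than `t` from both. -/
def gridInterval (t : ℝ) (a : ℤ) : Set ℝ :=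
  {x | (Even a → |x - (a / 2 : ℤ)| < t) ∧
    (¬ Even a → (a / 2 : ℤ) + t < x ∧ x < (a / 2 : ℤ) + 1 - t)}

lemma isOpen_gridInterval (t : ℝ) (a : ℤ) : IsOpen (gridInterval t a) := by
  by_cases h : Even a
  · simp only [gridInterval, h, not_true_eq_false, false_imp_iff, and_true, true_imp_iff]
    exact isOpen_lt (by fun_prop) continuous_const
  · simp only [gridInterval, h, false_imp_iff, true_and, not_false_iff, true_imp_iff]
    exact (isOpen_lt continuous_const continuous_id).inter
      (isOpen_lt continuous_id continuous_const)

lemma gridInterval_unique {t x : ℝ} {a b : ℤ} (h0 : 0 < t) (ht : t < 1 / 2)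
    (ha : x ∈ gridInterval t a) (hb : x ∈ gridInterval t b) : a = b := by
  have key : ∀ {m n : ℤ}, (m : ℝ) - n < 1 → m ≤ n := fun {m n} h => by
    have : (m : ℝ) < n + 1 := by linarith
    have : m < n + 1 := by exact_mod_cast this
    omega
  rcases Int.even_or_odd a with hea | hoa <;> rcases Int.even_or_odd b with heb | hob
  · have h1 := abs_lt.1 (ha.1 hea)
    have h2 := abs_lt.1 (hb.1 heb)
    have h3 : a / 2 ≤ b / 2 := key (by linarith)
    have h4 : b / 2 ≤ a / 2 := key (by linarith)
    obtain ⟨m, rfl⟩ := hea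
    obtain ⟨n, rfl⟩ := heb
    omega
  · have h1 := abs_lt.1 (ha.1 hea)
    have h2 := hb.2 (Int.not_even_iff_odd.2 hob)
    have h3 : a / 2 ≤ b / 2 := key (by linarith)
    have h4 : b / 2 + 1 ≤ a / 2 := key (by push_cast; linarith)
    omega
  · have h1 := abs_lt.1 (hb.1 heb)
    have h2 := ha.2 (Int.not_even_iff_odd.2 hoa)
    have h3 : b / 2 ≤ a / 2 := key (by linarith)
    have h4 : a / 2 + 1 ≤ b / 2 := key (by push_cast; linarith)
    omega
  · have h1 := ha.2 (Int.not_even_iff_odd.2 hoa)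
    have h2 := hb.2 (Int.not_even_iff_odd.2 hob)
    have h3 : a / 2 ≤ b / 2 := key (by linarith)
    have h4 : b / 2 ≤ a / 2 := key (by linarith)
    obtain ⟨m, rfl⟩ := hoa
    obtain ⟨n, rfl⟩ := hob
    omega


lemma abs_sub_lt_one_of_mem_gridInterval {t x y : ℝ} {a : ℤ} (h0 : 0 < t) (ht : t < 1 / 2)
    (hx : x ∈ gridInterval t a) (hy : y ∈ gridInterval t a) : |x - y| < 1 := by
  rw [abs_lt]
  by_cases h : Even a
  · have h1 := abs_lt.1 (hx.1 h)
    have h2 := abs_lt.1 (hy.1 h)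
    constructor <;> linarith
  · have h1 := hx.2 h
    have h2 := hy.2 h
    constructor <;> linarith

lemma mem_gridInterval_even {t x : ℝ} (h : |x - round x| < t) :
    x ∈ gridInterval t (2 * round x) := by
  refine ⟨fun _ => ?_, fun h' => absurd (even_two_mul _) h'⟩
  rwa [Int.mul_ediv_cancel_left _ two_ne_zero]

lemma mem_gridInterval_odd {t x : ℝ} (h : t < |x - round x|) :
    x ∈ gridInterval t (2 * ⌊x⌋ + 1) := by
  refine ⟨fun h' => absurd h' (Int.not_even_two_mul_add_one _), fun _ => ?_⟩
  have h0 : (2 * ⌊x⌋ + 1) / 2 = ⌊x⌋ := by omega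
  rw [h0]
  have h1 := h.trans_le (round_le x ⌊x⌋)
  have h2 := h.trans_le (round_le x (⌊x⌋ + 1))
  rw [abs_of_nonneg (by linarith [Int.floor_le x])] at h1
  rw [abs_of_nonpos (by push_cast; linarith [Int.lt_floor_add_one x])] at h2
  push_cast at h2
  constructor <;> linarith

/-- The unit sphere of the sup norm of `ℝ^(n+1)` has arbitrarily fine open covers of order at most
`n`. The space is cut by a fine cubical grid, and the cover consists of `n + 1` disjoint families:
the `j`-th one contains thickened `j`-dimensional cells, those where exactly `j` coordinates are
away from the grid. On the sphere some coordinate lies on the grid, so `j = n + 1` is not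
needed. -/
lemma exists_fine_cover_sphere (n : ℕ) {η : ℝ} (hη : 0 < η) :
    ∃ U : Fin (n + 1) × (Fin (n + 1) → ℤ) → Set (Fin (n + 1) → ℝ), (∀ i, IsOpen (U i)) ∧
      (∀ y, ‖y‖ = 1 → ∃ i, y ∈ U i) ∧ (∀ i, ∀ y ∈ U i, ∀ z ∈ U i, dist y z < η) ∧
      ∀ (σ : Finset (Fin (n + 1) × (Fin (n + 1) → ℤ))) (y : Fin (n + 1) → ℝ),
        (∀ i ∈ σ, y ∈ U i) → σ.card ≤ n + 1 := by
  classical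
  obtain ⟨M, hM⟩ := exists_nat_gt (1 / η)
  have hM0 : (0 : ℝ) < M := lt_trans (by positivity) hM
  let t : ℕ → ℝ := fun j => 1 / (j + 3)
  have ht0 : ∀ j, 0 < t j := fun j => by simp only [t]; positivity
  have ht2 : ∀ j, t j < 1 / 2 := fun j => by
    simp only [t]
    rw [div_lt_div_iff₀ (by positivity) (by positivity)]
    have : (0 : ℝ) ≤ j := by positivity
    linarith
  have htanti : ∀ j, t (j + 1) < t j := fun j => by
    simp only [t]
    rw [div_lt_div_iff₀ (by positivity) (by positivity)]
    push_cast
    linarith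
  refine ⟨fun i => {y | (Finset.univ.filter fun l => ¬ Even (i.2 l)).card = i.1 ∧
    ∀ l, M * y l ∈ gridInterval (t i.1) (i.2 l)}, ?_, ?_, ?_, ?_⟩
  · intro i
    refine isOpen_const.inter ?_
    have : {y : Fin (n + 1) → ℝ | ∀ l, M * y l ∈ gridInterval (t i.1) (i.2 l)} =
        ⋂ l, (fun y : Fin (n + 1) → ℝ => M * y l) ⁻¹' gridInterval (t i.1) (i.2 l) := by
      ext y
      simp
    change IsOpen {y : Fin (n + 1) → ℝ | ∀ l, M * y l ∈ gridInterval (t i.1) (i.2 l)}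
    rw [this]
    exact isOpen_iInter_of_finite fun l => (isOpen_gridInterval _ _).preimage (by fun_prop)
  · intro y hy
    let d : Fin (n + 1) → ℝ := fun l => |M * y l - round (M * y l)|
    obtain ⟨l₀, hl₀⟩ : ∃ l, d l = 0 := by
      have hex : ∃ l, ‖y l‖ = 1 := by
        by_contra! hne
        have : ‖y‖ < 1 := (pi_norm_lt_iff one_pos).2 fun l =>
          lt_of_le_of_ne (hy ▸ norm_le_pi_norm y l) (hne l)
        linarith
      obtain ⟨l, hl⟩ := hex
      refine ⟨l, ?_⟩
      rw [Real.norm_eq_abs] at hl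
      rcases eq_or_eq_neg_of_abs_eq hl with h | h
      · have : (M : ℝ) * y l = ((M : ℤ) : ℝ) := by simp [h]
        simp only [d, this, round_intCast, sub_self, abs_zero]
      · have : (M : ℝ) * y l = ((-(M : ℤ) : ℤ) : ℝ) := by simp [h]
        simp only [d, this, round_intCast, sub_self, abs_zero]
    have hn : (Finset.univ.filter fun l => t n ≤ d l).card ≤ n := by
      have h1 : (Finset.univ.filter fun l => t n ≤ d l) ⊆ Finset.univ.erase l₀ := fun l hl => by
        refine Finset.mem_erase.2 ⟨?_, Finset.mem_univ _⟩
        rintro rfl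
        have := (Finset.mem_filter.1 hl).2
        linarith [ht0 n]
      have := Finset.card_le_card h1
      rw [Finset.card_erase_of_mem (Finset.mem_univ _), Finset.card_univ, Fintype.card_fin] at this
      omega
    -- For the least `j` with at most `j` coordinates at distance `≥ t j` from the grid, exactly `j`
    -- coordinates are at distance `> t j`, because `t` is strictly decreasing.
    have hex : ∃ j, (Finset.univ.filter fun l => t j ≤ d l).card ≤ j := ⟨n, hn⟩
    let j := Nat.find hex
    have hj : (Finset.univ.filter fun l => t j ≤ d l).card ≤ j := Nat.find_spec hex
    have hjn : j < n + 1 := Nat.lt_succ_of_le (Nat.find_min' hex hn)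
    have hj' : j ≤ (Finset.univ.filter fun l => t j < d l).card := by
      rcases Nat.eq_zero_or_pos j with h0 | h0
      · omega
      · have h1 := Nat.find_min hex (show j - 1 < j by omega)
        have h2 : (Finset.univ.filter fun l => t (j - 1) ≤ d l) ⊆
            Finset.univ.filter fun l => t j < d l := fun l hl => by
          refine Finset.mem_filter.2 ⟨Finset.mem_univ _, ?_⟩
          have h3 := htanti (j - 1)
          rw [Nat.sub_add_cancel h0] at h3
          exact h3.trans_le (Finset.mem_filter.1 hl).2
        have := Finset.card_le_card h2
        omega
    have hsub : (Finset.univ.filter fun l => t j < d l) ⊆ Finset.univ.filter fun l => t j ≤ d l :=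
      Finset.monotone_filter_right _ fun l _ h => le_of_lt h
    have heq := Finset.eq_of_subset_of_card_le hsub (hj.trans hj')
    refine ⟨⟨⟨j, hjn⟩, fun l => if t j < d l then 2 * ⌊M * y l⌋ + 1 else 2 * round (M * y l)⟩,
      ?_, fun l => ?_⟩
    · have hcard := le_antisymm ((Finset.card_le_card hsub).trans hj) hj'
      refine (congrArg Finset.card (Finset.filter_congr fun l _ => ?_)).trans hcard
      simp only
      split_ifs with h <;> simp [h]
    · simp only
      split_ifs with h
      · exact mem_gridInterval_odd h
      · refine mem_gridInterval_even ?_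
        by_contra hn
        have : l ∈ Finset.univ.filter fun l => t j ≤ d l :=
          Finset.mem_filter.2 ⟨Finset.mem_univ _, not_lt.1 hn⟩
        rw [← heq] at this
        exact h (Finset.mem_filter.1 this).2
  · intro i y hy z hz
    rw [dist_pi_lt_iff hη]
    intro l
    have h1 := abs_sub_lt_one_of_mem_gridInterval (ht0 _) (ht2 _) (hy.2 l) (hz.2 l)
    rw [← mul_sub, abs_mul, abs_of_pos hM0] at h1
    rw [Real.dist_eq]
    rw [div_lt_iff₀ hη] at hM
    by_contra! hn
    have := mul_le_mul_of_nonneg_left hn hM0.le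
    linarith
  · intro σ y hσ
    have hinj : Set.InjOn Prod.fst (σ : Set (Fin (n + 1) × (Fin (n + 1) → ℤ))) := by
      rintro ⟨j, a⟩ ha ⟨j', b⟩ hb hjj
      simp only at hjj
      subst hjj
      have h1 := (hσ _ ha).2
      have h2 := (hσ _ hb).2
      refine Prod.ext rfl (funext fun l => gridInterval_unique (ht0 _) (ht2 _) (h1 l) (h2 l))
    rw [← Finset.card_image_of_injOn hinj]
    exact (Finset.card_le_univ _).trans_eq (Fintype.card_fin _)

/-! ### Approximate extension from the sphere to the ball -/

section Approximation

variable {E : Type v} [NormedAddCommGroup E] [NormedSpace ℝ E]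

/-- A map of the `n`-sphere into a small neighbourhood of a member `S` of a uniformly equi-`LC^n`
family is close to a map into `S`: a fine cover of the sphere of order at most `n` yields a map
through the nerve, which is mapped into `S` by `exists_simplicial_map`. -/
lemma exists_approx_sphere {𝒮 : Set (Set E)} {n : ℕ} (h𝒮 : UniformlyEquiLC n 𝒮) {ε : ℝ}
    (hε : 0 < ε) : ∃ δ : ℝ, 0 < δ ∧ ∀ S ∈ 𝒮, ∀ g : EuclideanSpace ℝ (Fin (n + 1)) → E,
      ContinuousOn g (unitSphere n) → MapsTo g (unitSphere n) (thickening δ S) →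
      ∃ g' : EuclideanSpace ℝ (Fin (n + 1)) → E, ContinuousOn g' (unitSphere n) ∧
        MapsTo g' (unitSphere n) S ∧ ∀ x ∈ unitSphere n, dist (g x) (g' x) < ε := by
  classical
  obtain ⟨δ₁, hδ₁, hδ₁ε, H⟩ := exists_simplicial_map (ι := Fin (n + 1) × (Fin (n + 1) → ℤ)) h𝒮 n
    (Nat.le_succ n) (ε / 2) (by positivity)
  refine ⟨δ₁ / 4, by positivity, fun S hS g hg hgS => ?_⟩
  let K : Set (Fin (n + 1) → ℝ) := Metric.sphere 0 1
  have : CompactSpace K := isCompact_iff_compactSpace.1 (isCompact_sphere _ _)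
  have hd0 : ∀ y : K, ‖WithLp.toLp 2 (y : Fin (n + 1) → ℝ)‖ ≠ 0 := by
    intro y h
    rw [norm_eq_zero, WithLp.toLp_eq_zero] at h
    have := y.2
    simp [K, h] at this
  let d : K → EuclideanSpace ℝ (Fin (n + 1)) := fun y =>
    ‖WithLp.toLp 2 (y : Fin (n + 1) → ℝ)‖⁻¹ • WithLp.toLp 2 (y : Fin (n + 1) → ℝ)
  have hd : Continuous d := by
    have h1 : Continuous fun y : K => WithLp.toLp 2 (y : Fin (n + 1) → ℝ) := by fun_prop
    exact (h1.norm.inv₀ hd0).smul h1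
  have hdS : ∀ y, d y ∈ unitSphere n := fun y => by
    rw [unitSphere, mem_sphere_zero_iff_norm, norm_smul, norm_inv, norm_norm,
      inv_mul_cancel₀ (hd0 y)]
  have hc0 : ∀ x : unitSphere n, ‖WithLp.ofLp (x : EuclideanSpace ℝ (Fin (n + 1)))‖ ≠ 0 := by
    intro x h
    rw [norm_eq_zero, WithLp.ofLp_eq_zero] at h
    have := x.2
    simp [unitSphere, h] at this
  let c : unitSphere n → K := fun x =>
    ⟨‖WithLp.ofLp (x : EuclideanSpace ℝ (Fin (n + 1)))‖⁻¹ •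
      WithLp.ofLp (x : EuclideanSpace ℝ (Fin (n + 1))), by
      rw [mem_sphere_zero_iff_norm, norm_smul, norm_inv, norm_norm, inv_mul_cancel₀ (hc0 x)]⟩
  have hc : Continuous c := by
    have h1 : Continuous fun x : unitSphere n =>
      WithLp.ofLp (x : EuclideanSpace ℝ (Fin (n + 1))) := by fun_prop
    exact ((h1.norm.inv₀ hc0).smul h1).subtype_mk _
  have hdc : ∀ x, d (c x) = x := by
    intro x
    have hx : ‖(x : EuclideanSpace ℝ (Fin (n + 1)))‖ = 1 := mem_sphere_zero_iff_norm.1 x.2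
    simp only [d, c, WithLp.toLp_smul, WithLp.toLp_ofLp, norm_smul, norm_inv, norm_norm, hx,
      mul_one, inv_inv, smul_smul, mul_inv_cancel₀ (hc0 x), one_smul]
  let G : K → E := fun y => g (d y)
  have hG : Continuous G := hg.comp_continuous hd hdS
  obtain ⟨η, hη, hGη⟩ := Metric.uniformContinuous_iff.1
    (CompactSpace.uniformContinuous_of_continuous hG) (δ₁ / 4) (by positivity)
  obtain ⟨U, hUo, hUc, hUd, hUord⟩ := exists_fine_cover_sphere n hη
  have hv : ∀ i, ∃ v ∈ S, ∀ y : K, (y : Fin (n + 1) → ℝ) ∈ U i → dist (G y) v < δ₁ / 2 := by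
    intro i
    by_cases hi : ∃ y : K, (y : Fin (n + 1) → ℝ) ∈ U i
    · obtain ⟨y, hy⟩ := hi
      obtain ⟨v, hvS, hv⟩ := mem_thickening_iff.1 (hgS (hdS y))
      refine ⟨v, hvS, fun z hz => ?_⟩
      have h1 : dist (G z) (G y) < δ₁ / 4 := hGη (hUd i _ hz _ hy)
      have := dist_triangle (G z) (G y) v
      have h2 : dist (G y) v < δ₁ / 4 := hv
      linarith
    · obtain ⟨v, hvS⟩ := h𝒮.1 S hS
      exact ⟨v, hvS, fun y hy => absurd ⟨y, hy⟩ hi⟩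
  choose v hvS hvd using hv
  obtain ⟨F, hF⟩ := H S hS v hvS {σ | ∃ y : K, ∀ i ∈ σ, (y : Fin (n + 1) → ℝ) ∈ U i}
    (fun τ ⟨y, hy⟩ σ hσ => ⟨y, fun i hi => hy i (hσ hi)⟩) (by
      rintro τ ⟨y, hy⟩ i hi j hj
      have h1 := hvd i y (hy i hi)
      have h2 := hvd j y (hy j hj)
      have := dist_triangle_left (v i) (v j) (G y)
      linarith)
  obtain ⟨p, hp⟩ := PartitionOfUnity.exists_isSubordinate (isClosed_univ (X := K))
    (fun i => ((↑) : K → (Fin (n + 1) → ℝ)) ⁻¹' U i)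
    (fun i => (hUo i).preimage continuous_subtype_val) (fun y _ => by
      obtain ⟨i, hi⟩ := hUc y (mem_sphere_zero_iff_norm.1 y.2)
      exact mem_iUnion.2 ⟨i, hi⟩)
  have hpU : ∀ i (y : K), p i y ≠ 0 → (y : Fin (n + 1) → ℝ) ∈ U i := fun i y h =>
    hp i (subset_tsupport _ h)
  have hcont : Continuous fun y => F fun i => p i y :=
    continuous_comp_partitionOfUnity p fun σ ⟨y, hy⟩ =>
      (hF σ ⟨y, fun i hi => hpU i y (hy i hi)⟩
        (hUord σ y fun i hi => hpU i y (hy i hi))).1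
  have hval : ∀ y, (F fun i => p i y) ∈ S ∧ dist (G y) (F fun i => p i y) < ε := by
    intro y
    obtain ⟨σ, hσ, hpσ⟩ := exists_mem_coordSimplex_partitionOfUnity p y
    have hU : ∀ i ∈ σ, (y : Fin (n + 1) → ℝ) ∈ U i := fun i hi => hpU i y (hσ i hi)
    obtain ⟨h1, h2⟩ := (hF σ ⟨y, hU⟩ (hUord σ y hU)).2 _ hpσ
    obtain ⟨i, hi, -⟩ := exists_pos_of_mem_coordSimplex hpσ
    have h3 := hvd i y (hU i hi)
    have h4 := h2 i hi
    have := dist_triangle_right (G y) (F fun i => p i y) (v i)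
    exact ⟨h1, by linarith⟩
  refine ⟨fun x => if hx : x ∈ unitSphere n then F fun i => p i (c ⟨x, hx⟩) else 0, ?_, ?_, ?_⟩
  · rw [continuousOn_iff_continuous_domRestrict]
    refine (hcont.comp hc).congr fun x => ?_
    simp
  · intro x hx
    simp only [dif_pos hx]
    exact (hval _).1
  · intro x hx
    simp only [dif_pos hx]
    have := (hval (c ⟨x, hx⟩)).2
    simp only [G, hdc] at this
    exact this

/-- A small map of the unit sphere extends to a small map of the unit ball, by coning off. -/
lemma exists_cone_extension {n : ℕ} {e : EuclideanSpace ℝ (Fin (n + 1)) → E}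
    (he : ContinuousOn e (unitSphere n)) {ε : ℝ} (hε : 0 < ε)
    (hbound : ∀ x ∈ unitSphere n, ‖e x‖ < ε) :
    ∃ e' : EuclideanSpace ℝ (Fin (n + 1)) → E, ContinuousOn e' (unitBall n) ∧
      EqOn e' e (unitSphere n) ∧ ∀ x ∈ unitBall n, ‖e' x‖ < ε := by
  have hmem : ∀ x : EuclideanSpace ℝ (Fin (n + 1)), x ≠ 0 → ‖x‖⁻¹ • x ∈ unitSphere n :=
    fun x hx => by
      rw [unitSphere, mem_sphere_zero_iff_norm, norm_smul, norm_inv, norm_norm,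
        inv_mul_cancel₀ (norm_ne_zero_iff.2 hx)]
  have hle : ∀ x : EuclideanSpace ℝ (Fin (n + 1)), ‖‖x‖ • e (‖x‖⁻¹ • x)‖ ≤ ‖x‖ * ε := by
    intro x
    rw [norm_smul, norm_norm]
    by_cases hx : x = 0
    · simp [hx]
    · exact mul_le_mul_of_nonneg_left (hbound _ (hmem x hx)).le (norm_nonneg _)
  refine ⟨fun x => ‖x‖ • e (‖x‖⁻¹ • x), ?_, ?_, ?_⟩
  · intro x _
    refine ContinuousAt.continuousWithinAt ?_
    by_cases hx : x = 0
    · subst hx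
      rw [ContinuousAt, norm_zero, zero_smul]
      refine squeeze_zero_norm hle ?_
      have : Continuous fun x : EuclideanSpace ℝ (Fin (n + 1)) => ‖x‖ * ε := by fun_prop
      simpa using this.tendsto 0
    · have h1 : ContinuousOn (fun x : EuclideanSpace ℝ (Fin (n + 1)) => ‖x‖⁻¹ • x) {0}ᶜ :=
        (continuous_norm.continuousOn.inv₀ fun y hy => norm_ne_zero_iff.2 hy).smul continuousOn_id
      have h2 : ContinuousOn (fun x : EuclideanSpace ℝ (Fin (n + 1)) => ‖x‖ • e (‖x‖⁻¹ • x))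
          {0}ᶜ :=
        continuous_norm.continuousOn.smul (he.comp h1 fun y hy => hmem y hy)
      exact h2.continuousAt (isOpen_compl_singleton.mem_nhds hx)
  · intro x hx
    have : ‖x‖ = 1 := mem_sphere_zero_iff_norm.1 hx
    simp [this]
  · intro x hx
    have hx1 : ‖x‖ ≤ 1 := mem_closedBall_zero_iff.1 hx
    by_cases hx0 : x = 0
    · simpa [hx0] using hε
    · rw [norm_smul, norm_norm]
      exact (mul_le_of_le_one_left (norm_nonneg _) hx1).trans_lt (hbound _ (hmem x hx0))

/-- An approximate form of the relation `S ↪ₖ B`, for the boundary of a simplex: a map of the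
boundary into a small neighbourhood of `S` extends to a map of the simplex into a prescribed
neighbourhood of `B`. -/
lemma exists_approx_extension {𝒮 : Set (Set E)} {k : ℕ} (h𝒮 : UniformlyEquiLC k 𝒮) {ε : ℝ}
    (hε : 0 < ε) : ∃ δ : ℝ, 0 < δ ∧ ∀ S ∈ 𝒮, ∀ B : Set E, SphereExtends k S B →
      ∀ {ι : Type u} {τ : Finset ι}, τ.card = k + 2 → ∀ g : (ι → ℝ) → E,
      ContinuousOn g (coordBoundary τ) → MapsTo g (coordBoundary τ) (thickening δ S) →
      ∃ h : (ι → ℝ) → E, ContinuousOn h (coordSimplex τ) ∧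
        MapsTo h (coordSimplex τ) (thickening ε B) ∧ EqOn h g (coordBoundary τ) := by
  obtain ⟨δ, hδ, hδS⟩ := exists_approx_sphere h𝒮 hε
  refine ⟨δ, hδ, fun S hS B hSB ι τ hτ g hg hgS => ?_⟩
  obtain ⟨r, s, hr, hs, hrB, hrS, hsB, hsr⟩ := exists_simplex_to_ball hτ
  have hgs : ContinuousOn (g ∘ s) (unitSphere k) := hg.comp hs.continuousOn hsB
  obtain ⟨g', hg', hg'S, hgg'⟩ := hδS S hS (g ∘ s) hgs (hgS.comp hsB)
  obtain ⟨H, hH, hHB, hHg⟩ := hSB g' hg' hg'S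
  obtain ⟨e, he, hee, heε⟩ := exists_cone_extension (hgs.sub hg') hε fun x hx => by
    have := hgg' x hx
    rwa [dist_eq_norm] at this
  refine ⟨fun p => H (r p) + e (r p),
    (hH.comp hr.continuousOn hrB).add (he.comp hr.continuousOn hrB), fun p hp => ?_,
    fun p hp => ?_⟩
  · refine mem_thickening_iff.2 ⟨H (r p), hHB (hrB hp), ?_⟩
    rw [dist_eq_norm, add_sub_cancel_left]
    exact heε _ (hrB hp)
  · simp only
    rw [hHg (hrS hp), hee (hrS hp)]
    simp [hsr p hp]

end Approximation

/-! ### Shrinking locally finite covers to covers of small order -/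

section Dowker

variable {X : Type u} [TopologicalSpace X] {ι : Type v}

/-- If a closed set `A` meets only finitely many members of an open cover, then closed subsets of
`A` can be removed from the members so that what remains is still a cover, of order at most `N`
at the points of `A`. -/
lemma CoveringDimLE.exists_closed_removal {N : ℕ} (hdim : CoveringDimLE X N) {U : ι → Set X}
    (hU : ∀ i, IsOpen (U i)) (hcov : ∀ x, ∃ i, x ∈ U i) {A : Set X} (hA : IsClosed A)
    (hfin : {i | (U i ∩ A).Nonempty}.Finite) :
    ∃ C : ι → Set X, (∀ i, IsClosed (C i)) ∧ (∀ i, C i ⊆ A) ∧ (∀ x, ∃ i, x ∈ U i \ C i) ∧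
      ∀ x ∈ A, ∀ σ : Finset ι, (∀ i ∈ σ, x ∈ U i \ C i) → σ.card ≤ N + 1 := by
  classical
  rcases isEmpty_or_nonempty ι with hι | hι
  · exact ⟨fun _ => ∅, fun _ => isClosed_empty, fun _ => empty_subset _,
      fun x => (IsEmpty.false (hcov x).choose).elim, fun x => (IsEmpty.false (hcov x).choose).elim⟩
  obtain ⟨𝒱, h𝒱o, h𝒱c, h𝒱r, h𝒱ord⟩ := hdim (insert Aᶜ (U '' {i | (U i ∩ A).Nonempty}))
    ((hfin.image U).insert _) (by
      rintro V (rfl | ⟨i, -, rfl⟩)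
      · exact hA.isOpen_compl
      · exact hU i) (by
      refine eq_univ_of_forall fun x => ?_
      by_cases hx : x ∈ A
      · obtain ⟨i, hi⟩ := hcov x
        exact ⟨U i, Or.inr ⟨i, ⟨x, hi, hx⟩, rfl⟩, hi⟩
      · exact ⟨Aᶜ, Or.inl rfl, hx⟩)
  have hex : ∀ V ∈ 𝒱, (V ∩ A).Nonempty → ∃ i, V ⊆ U i := by
    rintro V hV ⟨x, hxV, hxA⟩
    obtain ⟨W, rfl | ⟨i, -, rfl⟩, hVW⟩ := h𝒱r V hV
    · exact absurd hxA (hVW hxV)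
    · exact ⟨i, hVW⟩
  choose! c hc using hex
  let W : ι → Set X := fun i => ⋃₀ {V | V ∈ 𝒱 ∧ (V ∩ A).Nonempty ∧ c V = i}
  have hWo : ∀ i, IsOpen (W i) := fun i => isOpen_sUnion fun V hV => h𝒱o V hV.1
  refine ⟨fun i => A \ W i, fun i => hA.sdiff (hWo i), fun i => sdiff_subset, fun x => ?_, ?_⟩
  · by_cases hx : x ∈ A
    · obtain ⟨V, hV, hxV⟩ : x ∈ ⋃₀ 𝒱 := h𝒱c ▸ mem_univ x
      have hVA : (V ∩ A).Nonempty := ⟨x, hxV, hx⟩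
      exact ⟨c V, hc V hV hVA hxV, fun h => h.2 ⟨V, ⟨hV, hVA, rfl⟩, hxV⟩⟩
    · obtain ⟨i, hi⟩ := hcov x
      exact ⟨i, hi, fun h => hx h.1⟩
  · intro x hx σ hσ
    have hW : ∀ i ∈ σ, ∃ V, V ∈ 𝒱 ∧ c V = i ∧ x ∈ V := fun i hi => by
      have : x ∈ W i := by
        by_contra hn
        exact (hσ i hi).2 ⟨hx, hn⟩
      obtain ⟨V, ⟨hV, -, hVi⟩, hxV⟩ := this
      exact ⟨V, hV, hVi, hxV⟩
    choose! V hV hVc hxV using hW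
    have hinj : Set.InjOn V σ := fun i hi j hj hij => by
      rw [← hVc i hi, ← hVc j hj, hij]
    by_contra hcard
    have hempty := h𝒱ord (V '' σ) (by rintro _ ⟨i, hi, rfl⟩; exact hV i hi) (by
      rw [hinj.encard_image, Set.encard_coe_eq_coe_finsetCard]
      exact_mod_cast (by omega : N + 2 ≤ σ.card))
    have : x ∈ ⋂₀ (V '' (σ : Set ι)) := by
      rintro _ ⟨i, hi, rfl⟩
      exact hxV i hi
    rw [hempty] at this
    exact this

/-- Transfinite iteration of `CoveringDimLE.exists_closed_removal` along a locally finite closed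
cover `A`. Near each point only finitely many steps remove anything, so the sets stay open and the
covering property survives limit steps. -/
lemma CoveringDimLE.exists_shrinking_of_closed_cover {N : ℕ} (hdim : CoveringDimLE X N)
    {U : ι → Set X} (hU : ∀ i, IsOpen (U i)) (hcov : ∀ x, ∃ i, x ∈ U i) {T : Type w}
    [LinearOrder T] [WellFoundedLT T] {A : T → Set X} (hAc : ∀ t, IsClosed (A t))
    (hAf : LocallyFinite A) (hAcov : ∀ x, ∃ t, x ∈ A t)
    (hfin : ∀ t, {i | (U i ∩ A t).Nonempty}.Finite) :
    ∃ V : ι → Set X, (∀ i, IsOpen (V i)) ∧ (∀ i, V i ⊆ U i) ∧ (∀ x, ∃ i, x ∈ V i) ∧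
      ∀ x, ∀ σ : Finset ι, (∀ i ∈ σ, x ∈ V i) → σ.card ≤ N + 1 := by
  classical
  have hstep : ∀ (t : T) (W : ι → Set X), ∃ C : ι → Set X, (∀ i, IsClosed (C i)) ∧
      (∀ i, C i ⊆ A t) ∧ ((∀ i, IsOpen (W i)) → (∀ i, W i ⊆ U i) → (∀ x, ∃ i, x ∈ W i) →
        (∀ x, ∃ i, x ∈ W i \ C i) ∧
        ∀ x ∈ A t, ∀ σ : Finset ι, (∀ i ∈ σ, x ∈ W i \ C i) → σ.card ≤ N + 1) := by
    intro t W
    by_cases hW : (∀ i, IsOpen (W i)) ∧ (∀ i, W i ⊆ U i) ∧ ∀ x, ∃ i, x ∈ W i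
    · obtain ⟨C, h1, h2, h3⟩ := hdim.exists_closed_removal hW.1 hW.2.2 (hAc t)
        ((hfin t).subset fun i hi => hi.mono (inter_subset_inter_left _ (hW.2.1 i)))
      exact ⟨C, h1, h2, fun _ _ _ => h3⟩
    · exact ⟨fun _ => ∅, fun _ => isClosed_empty, fun _ => empty_subset _,
        fun h1 h2 h3 => absurd ⟨h1, h2, h3⟩ hW⟩
  choose c hcc hcA hc using hstep
  -- `R t i` is the closed set removed from the `i`-th member at the step `t`, and `V D i` is what
  -- remains of that member after the steps in `D`.
  let R : T → ι → Set X := (wellFounded_lt (α := T)).fix fun t R =>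
    c t fun i => U i \ ⋃ (s) (h : s < t), R s h i
  let V : Set T → ι → Set X := fun D i => U i \ ⋃ s ∈ D, R s i
  have hR : ∀ t, R t = c t (V (Iio t)) := fun t => WellFounded.fix_eq _ _ t
  have hRA : ∀ t i, R t i ⊆ A t := fun t i => by rw [hR]; exact hcA _ _ _
  have hVo : ∀ D i, IsOpen (V D i) := by
    intro D i
    refine (hU i).sdiff (LocallyFinite.isClosed_iUnion (hAf.subset fun s => ?_) fun s => ?_)
    · exact iUnion_subset fun _ => hRA s i
    · refine isClosed_iUnion_of_finite fun _ => ?_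
      rw [hR]
      exact hcc _ _ _
  have hVU : ∀ D i, V D i ⊆ U i := fun D i => sdiff_subset
  have hVanti : ∀ {D D' : Set T}, D ⊆ D' → ∀ i, V D' i ⊆ V D i := fun h i =>
    sdiff_subset_sdiff_right (biUnion_subset_biUnion_left h)
  have hVsucc : ∀ t i, V (Iic t) i = V (Iio t) i \ c t (V (Iio t)) i := by
    intro t i
    rw [← hR]
    simp only [V]
    rw [← Iio_insert, biUnion_insert, sdiff_sdiff, union_comm]
  have hlim : ∀ D : Set T, (∀ t ∈ D, ∀ x, ∃ i, x ∈ V (Iic t) i) → ∀ x, ∃ i, x ∈ V D i := by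
    intro D hD x
    have hf : {t | t ∈ D ∧ x ∈ A t}.Finite := (hAf.point_finite x).subset fun t ht => ht.2
    rcases {t | t ∈ D ∧ x ∈ A t}.eq_empty_or_nonempty with he | hne
    · obtain ⟨i, hi⟩ := hcov x
      refine ⟨i, hi, fun h => ?_⟩
      obtain ⟨s, hs, hxs⟩ := mem_iUnion₂.1 h
      exact (he ▸ (⟨hs, hRA s i hxs⟩ : s ∈ {t | t ∈ D ∧ x ∈ A t}) : s ∈ (∅ : Set T))
    · obtain ⟨t, ht, hmax⟩ := hf.exists_maximal hne
      obtain ⟨i, hi⟩ := hD t ht.1 x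
      refine ⟨i, hi.1, fun h => ?_⟩
      obtain ⟨s, hs, hxs⟩ := mem_iUnion₂.1 h
      have hst : s ≤ t := (le_total s t).elim id fun hts => hmax ⟨hs, hRA s i hxs⟩ hts
      exact hi.2 (mem_iUnion₂.2 ⟨s, hst, hxs⟩)
  have hall : ∀ t, ∀ x, ∃ i, x ∈ V (Iic t) i := by
    intro t
    induction t using WellFoundedLT.induction with
    | ind t ih =>
      have := (hc t (V (Iio t)) (hVo _) (hVU _) (hlim _ fun s hs => ih s hs)).1
      intro x
      obtain ⟨i, hi⟩ := this x
      exact ⟨i, by rwa [hVsucc]⟩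
  refine ⟨V univ, hVo _, hVU _, hlim _ fun t _ => hall t, fun x σ hσ => ?_⟩
  obtain ⟨t, ht⟩ := hAcov x
  refine (hc t (V (Iio t)) (hVo _) (hVU _) (hlim _ fun s _ => hall s)).2 x ht σ fun i hi => ?_
  rw [← hVsucc]
  exact hVanti (subset_univ _) i (hσ i hi)

/-- Dowker's theorem: in a paracompact Hausdorff space with `dim X ≤ N`, every locally finite open
cover, not only every finite one, has an open shrinking of order at most `N`. -/
theorem CoveringDimLE.exists_shrinking [T2Space X] [ParacompactSpace X] {N : ℕ}
    (hdim : CoveringDimLE X N) {U : ι → Set X} (hU : ∀ i, IsOpen (U i))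
    (hcov : ∀ x, ∃ i, x ∈ U i) (hf : LocallyFinite U) :
    ∃ V : ι → Set X, (∀ i, IsOpen (V i)) ∧ (∀ i, V i ⊆ U i) ∧ (∀ x, ∃ i, x ∈ V i) ∧
      ∀ x, ∀ σ : Finset ι, (∀ i ∈ σ, x ∈ V i) → σ.card ≤ N + 1 := by
  have hG : ∀ x, ∃ G : Set X, IsOpen G ∧ x ∈ G ∧ {i | (U i ∩ G).Nonempty}.Finite := by
    intro x
    obtain ⟨G, hG, hGf⟩ := hf x
    obtain ⟨G', hG', hG'o, hxG'⟩ := mem_nhds_iff.1 hG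
    exact ⟨G', hG'o, hxG', hGf.subset fun i hi => hi.mono (inter_subset_inter_right _ hG')⟩
  choose G hGo hxG hGf using hG
  obtain ⟨O, hOo, hOc, hOf, hOG⟩ := precise_refinement G hGo
    (eq_univ_of_forall fun x => mem_iUnion.2 ⟨x, hxG x⟩)
  obtain ⟨_, _⟩ := exists_wellFoundedLT (α := X)
  refine hdim.exists_shrinking_of_closed_cover hU hcov (fun x => isClosed_closure (s := O x))
    hOf.closure (fun x => ?_) fun x => (hGf x).subset fun i hi => ?_
  · obtain ⟨y, hy⟩ := mem_iUnion.1 (hOc ▸ mem_univ x : x ∈ ⋃ y, O y)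
    exact ⟨y, subset_closure hy⟩
  · obtain ⟨y, hyU, hyO⟩ := hi
    obtain ⟨z, hzU, hzO⟩ := mem_closure_iff.1 hyO (U i) (hU i) hyU
    exact ⟨z, hzU, hOG x hzO⟩

end Dowker

/-! ### Approximate selections on the skeleta of nerves -/

section Selections

variable {X : Type u} [TopologicalSpace X] {E : Type v} [NormedAddCommGroup E]

/-- For a lower semi-continuous mapping, an approximate inclusion `C ⊆ Φ x` of a compact set
persists at nearby points. -/
lemma LowerHemicontinuous.eventually_subset_thickening {Φ : X → Set E}
    (hΦ : LowerHemicontinuous Φ) {ε : ℝ} {C : Set E} (hC : IsCompact C) {x : X}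
    (hx : C ⊆ thickening ε (Φ x)) : ∀ᶠ y in 𝓝 x, C ⊆ thickening ε (Φ y) := by
  refine hC.eventually_forall_of_forall_eventually (P := fun y c => c ∈ thickening ε (Φ y))
    fun c hc => ?_
  obtain ⟨z, hz, hcz⟩ := mem_thickening_iff.1 (hx hc)
  have hr : 0 < (ε - dist c z) / 2 := by linarith
  have h1 : ∀ᶠ y in 𝓝 x, (Φ y ∩ ball z ((ε - dist c z) / 2)).Nonempty :=
    (lowerHemicontinuous_iff_isOpen_inter_nonempty.1 hΦ _ isOpen_ball).mem_nhds
      ⟨z, hz, mem_ball_self hr⟩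
  filter_upwards [h1.prod_nhds (ball_mem_nhds c hr)] with q hq
  obtain ⟨⟨w, hw, hwz⟩, hq2⟩ := hq
  refine mem_thickening_iff.2 ⟨w, hw, ?_⟩
  rw [mem_ball] at hwz
  rw [dist_comm] at hwz
  have := dist_triangle4 q.2 c z w
  linarith

lemma SphereExtends.subset {k : ℕ} {S B : Set E} (h : SphereExtends k S B) : S ⊆ B := by
  intro y hy
  obtain ⟨g, -, hgB, hgS⟩ := h (fun _ => y) continuousOn_const fun _ _ => hy
  have h1 : (EuclideanSpace.single 0 1 : EuclideanSpace ℝ (Fin (k + 1))) ∈ unitSphere k := by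
    simp [unitSphere]
  have h2 : g (EuclideanSpace.single 0 1) = y := hgS h1
  rw [← h2]
  exact hgB (sphere_subset_closedBall h1)

/-- A map of the nerve of the cover `U`, given on the faces with at most `m` vertices, whose values
on a face lie within `δ` of `Φ x` for all points `x` common to the members of `U` that span the
face. -/
def IsSkeletalSelection {ι : Type w} (m : ℕ) (δ : ℝ) (U : ι → Set X) (Φ : X → Set E)
    (F : (ι → ℝ) → E) : Prop :=
  ∀ σ : Finset ι, σ.card ≤ m → (∃ x, ∀ i ∈ σ, x ∈ U i) → ContinuousOn F (coordSimplex σ) ∧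
    ∀ x, (∀ i ∈ σ, x ∈ U i) → MapsTo F (coordSimplex σ) (thickening δ (Φ x))

variable [ParacompactSpace X]

lemma exists_zero_skeletal_selection [NormedSpace ℝ E] {Φ : X → Set E} (hne : ∀ x, (Φ x).Nonempty)
    (hΦ : LowerHemicontinuous Φ) {δ : ℝ} (hδ : 0 < δ) :
    ∃ (U : X → Set X) (F : (X → ℝ) → E), (∀ i, IsOpen (U i)) ∧ (∀ x, ∃ i, x ∈ U i) ∧
      LocallyFinite U ∧ IsSkeletalSelection 1 δ U Φ F := by
  choose e he using hne
  obtain ⟨U, hUo, hUc, hUf, hUe⟩ := precise_refinement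
    (fun x => {y | (Φ y ∩ ball (e x) δ).Nonempty})
    (fun x => lowerHemicontinuous_iff_isOpen_inter_nonempty.1 hΦ _ isOpen_ball)
    (eq_univ_of_forall fun x => mem_iUnion.2 ⟨x, e x, he x, mem_ball_self hδ⟩)
  have hUc' : ∀ x, ∃ i, x ∈ U i := fun x => mem_iUnion.1 (hUc ▸ mem_univ x)
  refine ⟨U, fun p => ∑ᶠ i, p i • e i, hUo, hUc', hUf, fun σ hc _ => ?_⟩
  rcases σ.eq_empty_or_nonempty with rfl | hσ
  · rw [coordSimplex_empty]
    exact ⟨continuousOn_empty _, fun x _ p hp => hp.elim⟩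
  · obtain ⟨i, rfl⟩ := Finset.card_eq_one.1 (le_antisymm hc hσ.card_pos)
    refine ⟨continuousOn_const.congr (finsum_smul_eqOn_vertex e i), fun x hx p hp => ?_⟩
    rw [finsum_smul_eqOn_vertex e i hp]
    obtain ⟨z, hz, hze⟩ := hUe i (hx i (Finset.mem_singleton_self i))
    exact mem_thickening_iff.2 ⟨z, hz, by rwa [mem_ball, dist_comm] at hze⟩

variable [T2Space X]

/-- One more skeleton, at the price of a refinement of the cover. At each point `x` the finitely
many faces of dimension `k + 1` at `x` are filled near `Ψ x`; by lower semi-continuity the same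
fillings are good near `x`. The new cover is so fine that every face of its nerve maps to a face at
a point near which all of its realization takes place, and the new faces use the pulled back
fillings. -/
lemma IsSkeletalSelection.exists_succ {k : ℕ} {δ ε : ℝ} (hδε : δ ≤ ε) {Φ Ψ : X → Set E}
    (hsub : ∀ x, Φ x ⊆ Ψ x) (hΨ : LowerHemicontinuous Ψ)
    (hfill : ∀ (x : X) (τ : Finset X), τ.card = k + 2 → ∀ g : (X → ℝ) → E,
      ContinuousOn g (coordBoundary τ) → MapsTo g (coordBoundary τ) (thickening δ (Φ x)) →
      ∃ h : (X → ℝ) → E, ContinuousOn h (coordSimplex τ) ∧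
        MapsTo h (coordSimplex τ) (thickening ε (Ψ x)) ∧ EqOn h g (coordBoundary τ))
    {U : X → Set X} {F : (X → ℝ) → E} (hU : ∀ i, IsOpen (U i)) (hcov : ∀ x, ∃ i, x ∈ U i)
    (hf : LocallyFinite U) (hF : IsSkeletalSelection (k + 1) δ U Φ F) :
    ∃ (V : X → Set X) (F' : (X → ℝ) → E), (∀ i, IsOpen (V i)) ∧ (∀ x, ∃ i, x ∈ V i) ∧
      LocallyFinite V ∧ IsSkeletalSelection (k + 2) ε V Ψ F' := by
  classical
  have hthick : ∀ x, thickening δ (Φ x) ⊆ thickening ε (Ψ x) := fun x =>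
    (thickening_mono hδε _).trans (thickening_subset_of_subset _ (hsub x))
  have hex : ∀ (x : X) (τ : Finset X), ∃ h : (X → ℝ) → E,
      τ.card = k + 2 → (∀ i ∈ τ, x ∈ U i) → ContinuousOn h (coordSimplex τ) ∧
        MapsTo h (coordSimplex τ) (thickening ε (Ψ x)) ∧ EqOn h F (coordBoundary τ) := by
    intro x τ
    by_cases hτ : τ.card = k + 2 ∧ ∀ i ∈ τ, x ∈ U i
    swap
    · exact ⟨F, fun h1 h2 => absurd ⟨h1, h2⟩ hτ⟩
    obtain ⟨hc, hx⟩ := hτ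
    have hx' : ∀ i, ∀ j ∈ τ.erase i, x ∈ U j := fun i j hj => hx j (Finset.mem_of_mem_erase hj)
    have hface : ∀ i ∈ τ, (τ.erase i).card ≤ k + 1 := fun i hi => by
      rw [Finset.card_erase_of_mem hi]
      omega
    obtain ⟨h, h1, h2, h3⟩ := hfill x τ hc F
      (continuousOn_coordBoundary fun i hi => (hF _ (hface i hi) ⟨x, hx' i⟩).1) (by
        rintro p ⟨hp, i, hi, hpi⟩
        exact (hF _ (hface i hi) ⟨x, hx' i⟩).2 x (hx' i) (mem_coordSimplex_erase hp hpi))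
    exact ⟨h, fun _ _ => ⟨h1, h2, h3⟩⟩
  choose h hh using hex
  obtain ⟨O, hOc, hOo, hOU⟩ := exists_iUnion_eq_closure_subset hU hf.point_finite
    (eq_univ_of_forall fun x => mem_iUnion.2 (hcov x))
  have hOf : LocallyFinite fun i => closure (O i) := hf.subset hOU
  have hs : ∀ x, ∃ i, x ∈ O i := fun x => mem_iUnion.1 (hOc ▸ mem_univ x)
  choose s hs using hs
  have hW : ∀ x, ∃ W : Set X, IsOpen W ∧ x ∈ W ∧
      (∀ y ∈ W, ∀ i, y ∈ closure (O i) → x ∈ closure (O i)) ∧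
      ∀ y ∈ W, ∀ τ : Finset X, τ.card = k + 2 → (∀ i ∈ τ, x ∈ U i) →
        MapsTo (h x τ) (coordSimplex τ) (thickening ε (Ψ y)) := by
    intro x
    have hfin : {τ : Finset X | τ.card = k + 2 ∧ ∀ i ∈ τ, x ∈ U i}.Finite := by
      refine (Finset.finite_toSet (hf.point_finite x).toFinset.powerset).subset fun τ hτ => ?_
      simp only [Finset.coe_powerset, mem_preimage, mem_powerset_iff, Finite.coe_toFinset]
      exact fun i hi => hτ.2 i hi
    have h1 := hOf.eventually_subset (fun i => isClosed_closure) x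
    have h2 : ∀ᶠ y in 𝓝 x, ∀ τ ∈ {τ : Finset X | τ.card = k + 2 ∧ ∀ i ∈ τ, x ∈ U i},
        h x τ '' coordSimplex τ ⊆ thickening ε (Ψ y) := by
      refine (Filter.eventually_all_finite hfin).2 fun τ hτ => ?_
      obtain ⟨hc, hm, -⟩ := hh x τ hτ.1 hτ.2
      exact hΨ.eventually_subset_thickening ((isCompact_coordSimplex τ).image_of_continuousOn hc)
        hm.image_subset
    obtain ⟨W, hW, hWo, hxW⟩ := mem_nhds_iff.1 (h1.and h2)
    exact ⟨W, hWo, hxW, fun y hy i hi => (hW hy).1 hi,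
      fun y hy τ hc hx => mapsTo_iff_image_subset.2 ((hW hy).2 τ ⟨hc, hx⟩)⟩
  choose W hWo hxW hWO hWh using hW
  obtain ⟨V, hVo, hVc, hVf, hVsub⟩ := precise_refinement (fun x => O (s x) ∩ W x)
    (fun x => (hOo _).inter (hWo x))
    (eq_univ_of_forall fun x => mem_iUnion.2 ⟨x, hs x, hxW x⟩)
  have hVU : ∀ {i x}, x ∈ V i → x ∈ U (s i) := fun hx =>
    hOU _ (subset_closure (hVsub _ hx).1)
  have himage : ∀ {σ : Finset X} {x}, (∀ i ∈ σ, x ∈ V i) → ∀ j ∈ σ.image s, x ∈ U j := by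
    intro σ x hx j hj
    obtain ⟨i, hi, rfl⟩ := Finset.mem_image.1 hj
    exact hVU (hx i hi)
  -- Faces which `s` maps to faces with at most `k + 1` vertices need no new filling.
  have hold : ∀ σ : Finset X, (σ.image s).card ≤ k + 1 → (∃ x, ∀ i ∈ σ, x ∈ V i) →
      ContinuousOn (F ∘ pushCoord s) (coordSimplex σ) ∧ ∀ x, (∀ i ∈ σ, x ∈ V i) →
        MapsTo (F ∘ pushCoord s) (coordSimplex σ) (thickening ε (Ψ x)) := by
    rintro σ hc ⟨x, hx⟩
    obtain ⟨h1, h2⟩ := hF _ hc ⟨x, himage hx⟩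
    exact ⟨h1.comp (continuousOn_pushCoord s σ) (mapsTo_pushCoord s σ), fun y hy =>
      ((h2 y (himage hy)).mono_right (hthick y)).comp (mapsTo_pushCoord s σ)⟩
  have hnew : ∀ τ : Finset X, ∃ h' : (X → ℝ) → E, (∃ x, ∀ i ∈ τ, x ∈ V i) → τ.card = k + 2 →
      EqOn h' (F ∘ pushCoord s) (coordBoundary τ) ∧ ContinuousOn h' (coordSimplex τ) ∧
      ∀ x, (∀ i ∈ τ, x ∈ V i) → MapsTo h' (coordSimplex τ) (thickening ε (Ψ x)) := by
    intro τ
    by_cases hτ : (∃ x, ∀ i ∈ τ, x ∈ V i) ∧ τ.card = k + 2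
    swap
    · exact ⟨F, fun h1 h2 => absurd ⟨h1, h2⟩ hτ⟩
    obtain ⟨⟨z, hz⟩, hc⟩ := hτ
    rcases Nat.lt_or_ge (τ.image s).card (k + 2) with hlt | hge
    · exact ⟨F ∘ pushCoord s, fun _ _ => ⟨fun _ _ => rfl, hold τ (by omega) ⟨z, hz⟩⟩⟩
    have hc' : (τ.image s).card = k + 2 := le_antisymm (Finset.card_image_le.trans hc.le) hge
    have hinj : Set.InjOn s τ := Finset.card_image_iff.1 (hc'.trans hc.symm)
    obtain ⟨x₀, hx₀⟩ : τ.Nonempty := Finset.card_pos.1 (by omega)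
    -- `x₀` belongs to every `U (s i)`, because its neighbourhood `W x₀` meets `O (s i)` at `z`.
    have hx₀U : ∀ j ∈ τ.image s, x₀ ∈ U j := by
      intro j hj
      obtain ⟨i, hi, rfl⟩ := Finset.mem_image.1 hj
      exact hOU _ (hWO x₀ z (hVsub _ (hz x₀ hx₀)).2 _ (subset_closure (hVsub _ (hz i hi)).1))
    obtain ⟨h1, -, h3⟩ := hh x₀ (τ.image s) hc' hx₀U
    refine ⟨h x₀ (τ.image s) ∘ pushCoord s, fun _ _ => ⟨fun p hp =>
      h3 (mapsTo_pushCoord_boundary hinj hp),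
      h1.comp (continuousOn_pushCoord s τ) (mapsTo_pushCoord s τ), fun x hx => ?_⟩⟩
    exact (hWh x₀ x (hVsub _ (hx x₀ hx₀)).2 _ hc' hx₀U).comp (mapsTo_pushCoord s τ)
  choose h' hh' using hnew
  obtain ⟨F', hF'1, hF'2⟩ := exists_extend_skeleton (F ∘ pushCoord s)
    {τ | ∃ x, ∀ i ∈ τ, x ∈ V i} h' (k + 2) fun τ hτ hc => (hh' τ hτ hc).1
  refine ⟨V, F', hVo, fun x => mem_iUnion.1 (hVc ▸ mem_univ x), hVf, fun σ hc hσ => ?_⟩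
  rcases Nat.lt_or_ge σ.card (k + 2) with hlt | hge
  · obtain ⟨h1, h2⟩ := hold σ (Finset.card_image_le.trans (by omega)) hσ
    exact ⟨h1.congr (hF'1 σ hlt), fun x hx => (h2 x hx).congr (hF'1 σ hlt).symm⟩
  · have hc' : σ.card = k + 2 := le_antisymm hc hge
    obtain ⟨-, h1, h2⟩ := hh' σ hσ hc'
    exact ⟨h1.congr (hF'2 σ hσ hc'), fun x hx => (h2 x hx).congr (hF'2 σ hσ hc').symm⟩

/-- The inductive construction of approximate selections on the skeleta of nerves of finer and
finer covers. The precision needed at each stage depends only on the precision wanted at the next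
one, so `δ` is arbitrary. -/
lemma exists_skeletal_selection [NormedSpace ℝ E] {N : ℕ} {Φ : ℕ → X → Set E}
    (hne : ∀ k ≤ N, ∀ x, (Φ k x).Nonempty) (hlsc : ∀ k ≤ N, LowerHemicontinuous (Φ k))
    (hLC : ∀ k < N, UniformlyEquiLC k (Set.range (Φ k)))
    (hext : ∀ k < N, ∀ x, SphereExtends k (Φ k x) (Φ (k + 1) x)) :
    ∀ k ≤ N, ∀ δ : ℝ, 0 < δ → ∃ (U : X → Set X) (F : (X → ℝ) → E), (∀ i, IsOpen (U i)) ∧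
      (∀ x, ∃ i, x ∈ U i) ∧ LocallyFinite U ∧ IsSkeletalSelection (k + 1) δ U (Φ k) F := by
  intro k
  induction k with
  | zero =>
    intro hk δ hδ
    exact exists_zero_skeletal_selection (hne 0 hk) (hlsc 0 hk) hδ
  | succ k ih =>
    intro hk ε hε
    obtain ⟨δ, hδ, hfill⟩ := exists_approx_extension (hLC k hk) hε
    obtain ⟨U, F, hU, hcov, hf, hF⟩ := ih (by omega) (min δ ε) (by positivity)
    exact hF.exists_succ (min_le_right _ _) (fun x => (hext k hk x).subset) (hlsc _ hk)
      (fun x τ hτ g hg hgm => hfill _ (mem_range_self x) _ (hext k hk x) hτ g hg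
        (hgm.mono_right (thickening_mono (min_le_left _ _) _))) hU hcov hf

end Selections

/-- Here `N = n + 1` with `n ≥ -1`, so `k ≤ n` reads `k < N`; only the values `Φ 0, …, Φ N` of the
sequence matter. -/
theorem theorem5p4 {X : Type*} [TopologicalSpace X] [T2Space X] [ParacompactSpace X]
    {E : Type*} [NormedAddCommGroup E] [NormedSpace ℝ E] [CompleteSpace E]
    (N : ℕ) (hdim : CoveringDimLE X N)
    (Φ : ℕ → X → Set E)
    (hne : ∀ k ≤ N, ∀ x, (Φ k x).Nonempty)
    (hlsc : ∀ k ≤ N, LowerHemicontinuous (Φ k))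
    (hLC : ∀ k < N, UniformlyEquiLC k (Set.range (Φ k)))
    (hext : ∀ k < N, ∀ x, SphereExtends k (Φ k x) (Φ (k + 1) x)) :
    ∀ ε : ℝ, 0 < ε → ∃ f : X → E, Continuous f ∧ IsEpsSelection ε f (Φ N) := by
  intro ε hε
  obtain ⟨U, F, hU, hcov, hf, hF⟩ := exists_skeletal_selection hne hlsc hLC hext N le_rfl ε hε
  obtain ⟨V, hV, hVU, hVc, hVord⟩ := hdim.exists_shrinking hU hcov hf
  obtain ⟨p, hp⟩ := PartitionOfUnity.exists_isSubordinate (isClosed_univ (X := X)) V hV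
    (fun x _ => mem_iUnion.2 (hVc x))
  have hpV : ∀ i x, p i x ≠ 0 → x ∈ V i := fun i x h => hp i (subset_tsupport _ h)
  have key : ∀ (σ : Finset X) (x : X), (∀ i ∈ σ, p i x ≠ 0) →
      ContinuousOn F (coordSimplex σ) ∧ MapsTo F (coordSimplex σ) (thickening ε (Φ N x)) := by
    intro σ x hx
    have hxV : ∀ i ∈ σ, x ∈ V i := fun i hi => hpV i x (hx i hi)
    have hxU : ∀ i ∈ σ, x ∈ U i := fun i hi => hVU i (hxV i hi)
    obtain ⟨h1, h2⟩ := hF σ (hVord x σ hxV) ⟨x, hxU⟩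
    exact ⟨h1, h2 x hxU⟩
  refine ⟨fun x => F fun i => p i x,
    continuous_comp_partitionOfUnity p fun σ ⟨x, hx⟩ => (key σ x hx).1, fun x => ?_⟩
  obtain ⟨σ, hσ, hpσ⟩ := exists_mem_coordSimplex_partitionOfUnity p x
  exact (key σ x hσ).2 hpσ
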